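/- Let $N\ge 0$ be an integer. Diagrams are drawn with the first (longest) row at the bottom. A Young tableau has positive integer entries, weakly increasing along rows (from left to right) and strictly increasing along columns (from bottom to top). For a partition $\lambda$ whose diagram lies in the $N\times N$ square, let $\overline\lambda$ be the conjugate of the partition $\nu$ whose rows are the rows, read from top to bottom, of the complement of the diagram of $\lambda$ in the square. *The set $\mathcal T_N$.* It consists of all $N\times N$ squares divided into two complementary Young tableaux, i.e. of all squares obtained as follows from some $\lambda$ contained in the square and two Young tableaux $A$, $B$ of respective shapes $\lambda$, $\overline\lambda$ with entries in $\{1,\dots,N\}$. The tableau $A$ is put in its usual place, with each entry $i$ written as a letter $\delta_i$. The remaining boxes are filled with $B$, with each entry $i$ written as a letter $\chi_i$: the first, second, … rows of $B$ are written from top to bottom in the first, second, … columns of the square counted from the right (so the first, second, … columns of $B$ are written from right to left in the first, second, … rows of the square counted from the top). Let $\alpha_N$ be the number of elements of $\mathcal T_N$ for which the first row of $\lambda$ has length $N$. *Knuth's map.* Column insertion of $x$ into a tableau: if $x$ is strictly larger than all entries of the first column, put it in a new box at the top of this column; otherwise $x$ replaces the lowest entry of the column that is $\ge x$, and the replaced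 entry is inserted in the same way into the next column, and so on (a possibly empty column after the last one is allowed). For $M\in\mathcal M_{N\times N}(\{0,1\})$, list the positions $(u_1,v_1),\dots,(u_r,v_r)$ of the entries $1$ of $M$ in lexicographic order. Column insert $v_1,\dots,v_r$ successively, starting from the empty tableau, to get $T_1$; and form $T_2$ by writing $u_k$ in the conjugate of the box created by the $k$-th insertion. *Column complement.* For a tableau $T_2$ with entries in $\{1,\dots,N\}$ and at most $N$ columns, $\overline{T_2}$ is the tabloid whose $i$-th column ($1\le i\le N$) consists, increasingly from bottom to top, of the elements of $\{1,\dots,N\}$ that do not appear in the $(N-i+1)$-th column of $T_2$. Then: 1. $M\mapsto(T_1,T_2)$ is a bijection from $\mathcal M_{N\times N}(\{0,1\})$ onto the set of pairs of Young tableaux of conjugate shapes with entries in $\{1,\dots,N\}$. 2. $(T_1,T_2)\mapsto(T_1,\overline{T_2})$ is a bijection from this set of pairs onto the set of pairs of Young tableaux with entries in $\{1,\dots,N\}$ of shapes $\lambda,\overline\lambda$, where $\lambda$ runs over the partitions contained in the $N\times N$ square. 3. The map $\Phi$ which sends $M$ to the square made of $A=T_1$ and $B=\overline{T_2}$ is a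 bijection from $\mathcal M_{N\times N}(\{0,1\})$ onto $\mathcal T_N$. 4. $|\mathcal T_N|=2^{N^2}$. 5. If $N\ge 1$, then $\alpha_N=2^{N^2-1}$. -/

import Mathlib

namespace SquareTableaux

/-! Boxes are indexed from `0`: the box `(i, j)` is in the `i`-th row (row `0` is the first row,
drawn at the bottom) and in the `j`-th column (column `0` is the first column, drawn on the left).
A filling is a function `T : ℕ → ℕ → ℕ`, with value `0` outside of its diagram. -/

/-- `T` is a Young tableau of shape `μ` (rows weakly increasing, columns strictly increasing from
bottom to top) whose entries belong to `{1, …, N}`. -/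
def IsYoungTableau (N : ℕ) (μ : YoungDiagram) (T : ℕ → ℕ → ℕ) : Prop :=
  ∃ S : SemistandardYoungTableau μ,
    (∀ i j, S i j = T i j) ∧ ∀ i j, (i, j) ∈ μ → 1 ≤ S i j ∧ S i j ≤ N

/-- The Ferrers diagram `μ` is contained in the `N × N` square. -/
def FitsInSquare (N : ℕ) (μ : YoungDiagram) : Prop :=
  ∀ i j, (i, j) ∈ μ → i < N ∧ j < N

/-- The complementary partition of `μ` within the `N × N` square: the conjugate of the partition
`ν` whose rows are the rows of the complement of `μ` in the square, read from top to bottom.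
So `(i, j) ∈ ν` iff `(N - 1 - i, N - 1 - j) ∉ μ`, and the complementary diagram is `ν`
transposed. -/
def complementDiagram (N : ℕ) (μ : YoungDiagram) : YoungDiagram where
  cells := (Finset.range N ×ˢ Finset.range N).filter
    (fun b => (N - 1 - b.2, N - 1 - b.1) ∉ μ)
  isLowerSet := by
    rintro ⟨a, b⟩ ⟨c, d⟩ hle h
    have h1 : c ≤ a := hle.1
    have h2 : d ≤ b := hle.2
    simp only [Finset.coe_filter, Finset.mem_product, Finset.mem_range, Set.mem_ofPred_eq] at h ⊢
    refine ⟨⟨by omega, by omega⟩, fun hm => h.2 ?_⟩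
    exact μ.up_left_mem (by omega) (by omega) hm

/-! ### Column bumping and Knuth's map -/

/-- Bumping of `x` into one column (listed from bottom to top): `x` is put on the top if it is
strictly larger than all entries; otherwise it replaces the lowest entry which is `≥ x`, and
this entry is returned as the bumped one. -/
def bumpColumn (x : ℕ) : List ℕ → List ℕ × Option ℕ
  | [] => ([x], none)
  | y :: ys =>
    if x ≤ y then (x :: ys, some y)
    else (y :: (bumpColumn x ys).1, (bumpColumn x ys).2)

/-- Column insertion of `x` into a tableau given by the list of its columns (from left to right).
The result is the new tableau, together with the (row, column) coordinates of the new box. -/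
def columnInsert (x : ℕ) : List (List ℕ) → List (List ℕ) × (ℕ × ℕ)
  | [] => ([[x]], (0, 0))
  | c :: cs =>
    match bumpColumn x c with
    | (c', none) => (c' :: cs, (c.length, 0))
    | (c', some y) =>
      (c' :: (columnInsert y cs).1,
        ((columnInsert y cs).2.1, (columnInsert y cs).2.2 + 1))

/-- The two-rowed array of a `0`-`1` matrix: the positions `(u, v)` (row, column, counted from `1`)
of its `1`-entries, in the lexicographic order. -/
def arrayOfMatrix (N : ℕ) (M : Matrix (Fin N) (Fin N) (Fin 2)) : List (ℕ × ℕ) :=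
  ((List.finRange N ×ˢ List.finRange N).filter (fun p => M p.1 p.2 = 1)).map
    (fun p => ((p.1 : ℕ) + 1, (p.2 : ℕ) + 1))

/-- One step of Knuth's construction for the pair `(u, v)`: `v` is column inserted into the first
tableau, and `u` is placed in the second one, in the conjugate of the box that appeared. -/
def knuthStep (s : List (List ℕ) × (ℕ → ℕ → ℕ)) (p : ℕ × ℕ) :
    List (List ℕ) × (ℕ → ℕ → ℕ) :=
  ((columnInsert p.2 s.1).1,
    fun i j => if (j, i) = (columnInsert p.2 s.1).2 then p.1 else s.2 i j)

/-- The filling given by a list of columns. -/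
def fillingOfColumns (P : List (List ℕ)) : ℕ → ℕ → ℕ :=
  fun i j => (P.getD j []).getD i 0

/-- Knuth's map, sending a `0`-`1` matrix to the pair `(T₁, T₂)`. -/
def knuthMap (N : ℕ) (M : Matrix (Fin N) (Fin N) (Fin 2)) :
    (ℕ → ℕ → ℕ) × (ℕ → ℕ → ℕ) :=
  let s := (arrayOfMatrix N M).foldl knuthStep ([], fun _ _ => 0)
  (fillingOfColumns s.1, s.2)

/-- The pairs of Young tableaux of conjugate shapes, with entries in `{1, …, N}`. -/
def conjugatePairs (N : ℕ) : Set ((ℕ → ℕ → ℕ) × (ℕ → ℕ → ℕ)) :=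
  {p | ∃ μ : YoungDiagram, IsYoungTableau N μ p.1 ∧ IsYoungTableau N μ.transpose p.2}

/-! ### Column complements -/

/-- The tabloid whose `j`-th column (`j = 0, …, N - 1`) consists, in increasing order from bottom
to top, of the letters of `{1, …, N}` that do not appear in column `N - 1 - j` of `T`. -/
def columnComplement (N : ℕ) (T : ℕ → ℕ → ℕ) : ℕ → ℕ → ℕ :=
  fun i j =>
    if j < N then
      ((Finset.Icc 1 N \ (Finset.range N).image (fun k => T k (N - 1 - j))).sort
        (· ≤ ·)).getD i 0
    else 0

/-- `A` and `B` are Young tableaux with entries in `{1, …, N}`, of shapes `μ` and its complement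
within the `N × N` square. -/
def AreComplementary (N : ℕ) (μ : YoungDiagram) (A B : ℕ → ℕ → ℕ) : Prop :=
  FitsInSquare N μ ∧ IsYoungTableau N μ A ∧ IsYoungTableau N (complementDiagram N μ) B

/-- The pairs of complementary Young tableaux within the `N × N` square. -/
def complementaryPairs (N : ℕ) : Set ((ℕ → ℕ → ℕ) × (ℕ → ℕ → ℕ)) :=
  {p | ∃ μ : YoungDiagram, AreComplementary N μ p.1 p.2}

/-! ### Squares divided into two complementary tableaux -/

/-- The letters `δ_i` and `χ_i`. -/
inductive Letter : Type
  | delta : ℕ → Letter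
  | chi : ℕ → Letter

/-- The `N × N` square (row `0` at the bottom, column `0` on the left) obtained from `A` and `B`:
the boxes of `A` are in their usual places and carry letters `δ`; the remaining boxes carry
letters `χ` given by `B`, whose rows are placed from top to bottom, the first one in the rightmost
column of the square (so that the columns of `B` are placed from right to left, the first one in
the top row of the square). -/
def placeInSquare (N : ℕ) (A B : ℕ → ℕ → ℕ) : Fin N → Fin N → Letter :=
  fun r c => if A r c = 0 then Letter.chi (B c.rev r.rev) else Letter.delta (A r c)

/-- The set `𝒯_N` of all `N × N` squares divided into two complementary Young tableaux, the first
one filled with letters `δ_1, …, δ_N` and the second one with letters `χ_1, …, χ_N`. -/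
def dividedSquares (N : ℕ) : Set (Fin N → Fin N → Letter) :=
  {S | ∃ (μ : YoungDiagram) (A B : ℕ → ℕ → ℕ),
    AreComplementary N μ A B ∧ S = placeInSquare N A B}

/-- The number `α_N` of elements of `𝒯_N` whose first tableau has a first row of length `N`. -/
noncomputable def alpha (N : ℕ) : ℕ :=
  {S : Fin N → Fin N → Letter | ∃ (μ : YoungDiagram) (A B : ℕ → ℕ → ℕ),
    AreComplementary N μ A B ∧ μ.rowLen 0 = N ∧ S = placeInSquare N A B}.ncard

/-- The map `Φ`: if Knuth's map sends `M` to `(T₁, T₂)`, then `Φ M` is the square made of `T₁`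
and of the column complement of `T₂`. -/
def Phi (N : ℕ) (M : Matrix (Fin N) (Fin N) (Fin 2)) : Fin N → Fin N → Letter :=
  placeInSquare N (knuthMap N M).1 (columnComplement N (knuthMap N M).2)

end SquareTableaux

namespace SquareTableaux

/-! Column insertion is reversible once the position of the new box is known: going back through the
columns, the entry that did the bumping is the largest one not exceeding the bumped entry
(`columnInsert_inj`, `exists_columnInsert_eq`). So everything rests on reading the last box off
`T₂`. If `x < y` are inserted in succession, the second new box lies in a strictly higher row
(`columnInsert_row_lt`); if `y ≤ x`, it lies in a row that is no higher (`columnInsert_row_le`). In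
a lexicographic array equal first letters come with increasing second letters, so after conjugation
equal entries of `T₂` appear strictly from left to right. Hence `T₂` is a tableau, and the last box
carries the rightmost occurrence of its largest entry (`IsLastBox`). The second comparison shows
that stripping such boxes from any pair of conjugate shapes yields a lexicographic array, which is
the array of a unique `0`-`1` matrix. Two columns may stand side by side exactly when, for every
`x`, the left one has at least as many entries below `x` as the right one. Complementing in `{1, …,
N}` reverses this inequality, and so does reversing the order of the columns; therefore the column
complement of a tableau is a tableau. It is an involution, which gives the second bijection. Placing
the two tableaux in the square loses nothing, so all the sets have `2 ^ (N ^ 2)` elements. Finally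
`(A, B) ↦ (B, A)` preserves complementary pairs and exchanges those whose `A` contains the bottom
right box of the square with those whose `A` does not; this halves the count. -/

/-! ### Insertion into one column -/

/-- The column `d` may stand to the right of the column `c` in a tableau. -/
def Dom : List ℕ → List ℕ → Prop
  | _, [] => True
  | [], _ :: _ => False
  | a :: c, b :: d => a ≤ b ∧ Dom c d

@[simp] lemma dom_nil (c : List ℕ) : Dom c [] := by cases c <;> trivial

@[simp] lemma not_dom_nil_cons (b : ℕ) (d : List ℕ) : ¬ Dom [] (b :: d) := id

@[simp] lemma dom_cons_cons (a b : ℕ) (c d : List ℕ) :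
    Dom (a :: c) (b :: d) ↔ a ≤ b ∧ Dom c d := Iff.rfl

lemma Dom.length_le {c d : List ℕ} (h : Dom c d) : d.length ≤ c.length := by
  induction c generalizing d with
  | nil => cases d <;> simp_all
  | cons a c ih =>
    cases d with
    | nil => simp
    | cons b d => simpa using ih h.2

lemma dom_iff {c d : List ℕ} :
    Dom c d ↔ d.length ≤ c.length ∧ ∀ i < d.length, c.getD i 0 ≤ d.getD i 0 := by
  induction c generalizing d with
  | nil => cases d <;> simp
  | cons a c ih =>
    cases d with
    | nil => simp
    | cons b d =>
      rw [dom_cons_cons, ih]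
      constructor
      · rintro ⟨h1, h2, h3⟩
        refine ⟨by simpa using h2, fun i hi => ?_⟩
        cases i with
        | zero => simpa using h1
        | succ i => simpa using h3 i (by simpa using hi)
      · rintro ⟨h1, h2⟩
        refine ⟨by simpa using h2 0 (by simp), by simpa using h1, fun i hi => ?_⟩
        simpa using h2 (i + 1) (by simpa using hi)

lemma bumpColumn_cons_of_le {x y : ℕ} (ys : List ℕ) (h : x ≤ y) :
    bumpColumn x (y :: ys) = (x :: ys, some y) := by
  simp [bumpColumn, h]

lemma bumpColumn_cons_of_lt {x y : ℕ} (ys : List ℕ) (h : y < x) :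
    bumpColumn x (y :: ys) = (y :: (bumpColumn x ys).1, (bumpColumn x ys).2) := by
  simp [bumpColumn, h]

lemma bumpColumn_none {x : ℕ} {c c' : List ℕ} (h : bumpColumn x c = (c', none)) :
    c' = c ++ [x] ∧ ∀ z ∈ c, z < x := by
  induction c generalizing c' with
  | nil => simp_all [bumpColumn]
  | cons a c ih =>
    rcases le_or_gt x a with hx | hx
    · simp [bumpColumn_cons_of_le c hx] at h
    · rw [bumpColumn_cons_of_lt c hx, Prod.mk.injEq] at h
      obtain ⟨h1, h2⟩ := ih (Prod.ext rfl h.2)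
      refine ⟨by rw [← h.1]; simp only [h1]; rfl, ?_⟩
      simpa [hx] using h2

lemma bumpColumn_of_forall_lt {x : ℕ} {c : List ℕ} (h : ∀ z ∈ c, z < x) :
    bumpColumn x c = (c ++ [x], none) := by
  induction c with
  | nil => rfl
  | cons a c ih =>
    rw [bumpColumn_cons_of_lt c (h a (by simp)), ih fun z hz => h z (by simp [hz])]
    rfl

lemma bumpColumn_length {x y : ℕ} {c c' : List ℕ} (h : bumpColumn x c = (c', some y)) :
    c'.length = c.length := by
  induction c generalizing c' with
  | nil => simp [bumpColumn] at h
  | cons a c ih =>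
    rcases le_or_gt x a with hx | hx
    · rw [bumpColumn_cons_of_le c hx, Prod.mk.injEq] at h
      rw [← h.1]; rfl
    · rw [bumpColumn_cons_of_lt c hx, Prod.mk.injEq] at h
      rw [← h.1, List.length_cons, List.length_cons, ih (Prod.ext rfl h.2)]

lemma mem_bumpColumn (x : ℕ) (c : List ℕ) (z : ℕ) :
    (z ∈ (bumpColumn x c).1 ∨ (bumpColumn x c).2 = some z) ↔ (z = x ∨ z ∈ c) := by
  induction c with
  | nil => simp [bumpColumn]
  | cons a c ih =>
    rcases le_or_gt x a with hx | hx
    · rw [bumpColumn_cons_of_le c hx]; simp; tauto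
    · rw [bumpColumn_cons_of_lt c hx]; simp only [List.mem_cons]; tauto

lemma le_of_bumpColumn {x y : ℕ} {c c' : List ℕ} (h : bumpColumn x c = (c', some y)) :
    x ≤ y := by
  induction c generalizing c' with
  | nil => simp [bumpColumn] at h
  | cons a c ih =>
    rcases le_or_gt x a with hx | hx
    · rw [bumpColumn_cons_of_le c hx] at h; simp at h; omega
    · rw [bumpColumn_cons_of_lt c hx, Prod.mk.injEq] at h
      exact ih (Prod.ext rfl h.2)

lemma mem_bumpColumn_self (x : ℕ) (c : List ℕ) : x ∈ (bumpColumn x c).1 := by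
  induction c with
  | nil => simp [bumpColumn]
  | cons a c ih =>
    rcases le_or_gt x a with hx | hx
    · simp [bumpColumn_cons_of_le c hx]
    · simp [bumpColumn_cons_of_lt c hx, ih]

lemma bumpColumn_pairwise (x : ℕ) {c : List ℕ} (hc : c.Pairwise (· < ·)) :
    (bumpColumn x c).1.Pairwise (· < ·) := by
  induction c with
  | nil => simp [bumpColumn]
  | cons a c ih =>
    rw [List.pairwise_cons] at hc
    rcases le_or_gt x a with hx | hx
    · rw [bumpColumn_cons_of_le c hx, List.pairwise_cons]
      exact ⟨fun z hz => hx.trans_lt (hc.1 z hz), hc.2⟩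
    · rw [bumpColumn_cons_of_lt c hx, List.pairwise_cons]
      refine ⟨fun z hz => ?_, ih hc.2⟩
      rcases (mem_bumpColumn x c z).1 (Or.inl hz) with rfl | h
      · exact hx
      · exact hc.1 z h

/-- Entries only decrease when a column is bumped. -/
lemma Dom.bumpColumn_left {x y : ℕ} {c c' d : List ℕ} (h : bumpColumn x c = (c', some y))
    (hd : Dom c d) : Dom c' d := by
  induction c generalizing c' d with
  | nil => simp [bumpColumn] at h
  | cons a c ih =>
    rcases d with _ | ⟨b, d⟩
    · simp
    rcases le_or_gt x a with hx | hx
    · rw [bumpColumn_cons_of_le c hx, Prod.mk.injEq] at h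
      rw [← h.1]
      exact ⟨hx.trans hd.1, hd.2⟩
    · rw [bumpColumn_cons_of_lt c hx, Prod.mk.injEq] at h
      rw [← h.1]
      exact ⟨hd.1, ih (Prod.ext rfl h.2) hd.2⟩

/-- The entry of `d` next to `y`, if any, is at least `y`, so `y` enters `d` no higher than the row
it left in `c`. There its left neighbour is `x ≤ y`, or a smaller entry of `c`. -/
lemma Dom.bumpColumn {x y : ℕ} {c c' d : List ℕ} (h : bumpColumn x c = (c', some y))
    (hd : Dom c d) : Dom c' (bumpColumn y d).1 := by
  induction c generalizing c' d with
  | nil => simp [SquareTableaux.bumpColumn] at h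
  | cons a c ih =>
    have hxy := le_of_bumpColumn h
    rcases le_or_gt x a with hx | hx
    · rw [bumpColumn_cons_of_le c hx, Prod.mk.injEq, Option.some_inj] at h
      obtain ⟨rfl, rfl⟩ := h
      rcases d with _ | ⟨b, d⟩
      · exact ⟨hx, dom_nil _⟩
      · rw [bumpColumn_cons_of_le d hd.1]
        exact ⟨hx, hd.2⟩
    · rw [bumpColumn_cons_of_lt c hx, Prod.mk.injEq] at h
      obtain ⟨rfl, h⟩ := h
      rcases d with _ | ⟨b, d⟩
      · exact ⟨by omega, dom_nil _⟩
      rcases le_or_gt y b with hy | hy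
      · rw [bumpColumn_cons_of_le d hy]
        exact ⟨by omega, hd.2.bumpColumn_left (Prod.ext rfl h)⟩
      · rw [bumpColumn_cons_of_lt d hy]
        exact ⟨hd.1, ih (Prod.ext rfl h) hd.2⟩

/-- The columns `c` and `c'` differ only where `y` stands in the former and `x` in the latter, and
`hy` takes care of this row. -/
lemma Dom.of_bumpColumn_left {x y : ℕ} {c c' d : List ℕ}
    (h : SquareTableaux.bumpColumn x c = (c', some y)) (hd : Dom c' d) (hy : ∀ z ∈ d, y ≤ z) : Dom c d := by
  induction c generalizing c' d with
  | nil => simp [SquareTableaux.bumpColumn] at h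
  | cons a c ih =>
    rcases d with _ | ⟨b, d⟩
    · simp
    rcases le_or_gt x a with hx | hx
    · rw [bumpColumn_cons_of_le c hx, Prod.mk.injEq, Option.some_inj] at h
      obtain ⟨rfl, rfl⟩ := h
      exact ⟨hy b (by simp), hd.2⟩
    · rw [bumpColumn_cons_of_lt c hx, Prod.mk.injEq] at h
      obtain ⟨rfl, h⟩ := h
      exact ⟨hd.1, ih (Prod.ext rfl h) hd.2 fun z hz => hy z (by simp [hz])⟩

lemma Dom.of_bumpColumn {x y : ℕ} {c c' d : List ℕ} (hc : c.Pairwise (· < ·))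
    (hds : d.Pairwise (· < ·)) (h : SquareTableaux.bumpColumn x c = (c', some y))
    (hd : Dom c' (SquareTableaux.bumpColumn y d).1) : Dom c d := by
  induction c generalizing c' d with
  | nil => simp [SquareTableaux.bumpColumn] at h
  | cons a c ih =>
    rcases d with _ | ⟨b, d⟩
    · simp
    rw [List.pairwise_cons] at hc hds
    rcases le_or_gt x a with hx | hx
    · rw [bumpColumn_cons_of_le c hx, Prod.mk.injEq, Option.some_inj] at h
      obtain ⟨rfl, rfl⟩ := h
      rcases le_or_gt a b with hb | hb
      · rw [bumpColumn_cons_of_le d hb] at hd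
        exact ⟨hb, hd.2⟩
      -- Impossible case: the bottom entry of `bumpColumn a d` is at most `a`, whereas all entries
      -- of `c` exceed `a`.
      · rw [bumpColumn_cons_of_lt d hb] at hd
        exfalso
        have hd := hd.2
        rcases c with _ | ⟨e, c⟩
        · have := hd.length_le
          have h2 := List.length_pos_of_mem (mem_bumpColumn_self a d)
          simp at this
          simp [this] at h2
        · have he := hc.1 e (by simp)
          rcases d with _ | ⟨f, d⟩
          · have := hd.1
            omega
          rcases le_or_gt a f with hf | hf
          · rw [bumpColumn_cons_of_le d hf] at hd
            have := hd.1
            omega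
          · rw [bumpColumn_cons_of_lt d hf] at hd
            have := hd.1
            omega
    · rw [bumpColumn_cons_of_lt c hx, Prod.mk.injEq] at h
      obtain ⟨rfl, h⟩ := h
      rcases le_or_gt y b with hy | hy
      · rw [bumpColumn_cons_of_le d hy] at hd
        exact ⟨hd.1.trans hy, hd.2.of_bumpColumn_left (Prod.ext rfl h)
          fun z hz => hy.trans (hds.1 z hz).le⟩
      · rw [bumpColumn_cons_of_lt d hy] at hd
        exact ⟨hd.1, ih hc.2 hds.2 (Prod.ext rfl h) hd.2⟩

/-- Reverse bumping of `y` out of a column. -/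
lemma exists_bumpColumn_eq {y a : ℕ} {c' : List ℕ} (hc : (a :: c').Pairwise (· < ·))
    (hy : a ≤ y) : ∃ x c, a ≤ x ∧ c.Pairwise (· < ·) ∧
      bumpColumn x c = (a :: c', some y) := by
  induction c' generalizing a with
  | nil => exact ⟨a, [y], le_rfl, by simp, bumpColumn_cons_of_le _ hy⟩
  | cons e c' ih =>
    rw [List.pairwise_cons] at hc
    rcases le_or_gt e y with he | he
    · obtain ⟨x, c, h1, h2, h3⟩ := ih hc.2 he
      have hae := hc.1 e (by simp)
      refine ⟨x, a :: c, by omega, ?_, ?_⟩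
      · rw [List.pairwise_cons]
        refine ⟨fun z hz => ?_, h2⟩
        have := (mem_bumpColumn x c z).2 (Or.inr hz)
        rw [h3] at this
        rcases this with h | h
        · exact hc.1 z h
        · simp at h
          omega
      · rw [bumpColumn_cons_of_lt c (by omega), h3]
    · refine ⟨a, y :: e :: c', le_rfl, ?_, bumpColumn_cons_of_le _ hy⟩
      rw [List.pairwise_cons]
      refine ⟨fun z hz => ?_, hc.2⟩
      rw [List.mem_cons] at hz
      rcases hz with rfl | hz
      · exact he
      · exact he.trans ((List.pairwise_cons.1 hc.2).1 z hz)

/-- In `c'` the entry `x` is the largest one that is `≤ y`, so `c'` and `y` determine it. -/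
lemma bumpColumn_inj {x x₂ y : ℕ} {c c₂ c' : List ℕ} (hc : c.Pairwise (· < ·))
    (hc₂ : c₂.Pairwise (· < ·)) (h : bumpColumn x c = (c', some y))
    (h₂ : bumpColumn x₂ c₂ = (c', some y)) : x = x₂ ∧ c = c₂ := by
  induction c generalizing c' c₂ with
  | nil => simp [bumpColumn] at h
  | cons a c ih =>
    rcases c₂ with _ | ⟨b, c₂⟩
    · simp [bumpColumn] at h₂
    have hxy := le_of_bumpColumn h
    have hxy₂ := le_of_bumpColumn h₂
    rw [List.pairwise_cons] at hc hc₂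
    rcases le_or_gt x a with hx | hx <;> rcases le_or_gt x₂ b with hb | hb
    · rw [bumpColumn_cons_of_le c hx] at h
      rw [bumpColumn_cons_of_le c₂ hb] at h₂
      have h3 := h.trans h₂.symm
      simp only [Prod.mk.injEq, List.cons.injEq, Option.some_inj] at h3
      obtain ⟨⟨rfl, rfl⟩, rfl⟩ := h3
      exact ⟨rfl, rfl⟩
    · rw [bumpColumn_cons_of_le c hx, Prod.mk.injEq, Option.some_inj] at h
      rw [bumpColumn_cons_of_lt c₂ hb, Prod.mk.injEq] at h₂
      have h3 := h.1.trans h₂.1.symm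
      rw [List.cons.injEq] at h3
      have := hc.1 x₂ (by rw [h3.2]; exact mem_bumpColumn_self _ _)
      omega
    · rw [bumpColumn_cons_of_le c₂ hb, Prod.mk.injEq, Option.some_inj] at h₂
      rw [bumpColumn_cons_of_lt c hx, Prod.mk.injEq] at h
      have h3 := h₂.1.trans h.1.symm
      rw [List.cons.injEq] at h3
      have := hc₂.1 x (by rw [h3.2]; exact mem_bumpColumn_self _ _)
      omega
    · rw [bumpColumn_cons_of_lt c₂ hb, Prod.mk.injEq] at h₂
      rw [bumpColumn_cons_of_lt c hx, Prod.mk.injEq] at h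
      have h3 := h₂.1.trans h.1.symm
      rw [List.cons.injEq] at h3
      obtain ⟨h4, h5⟩ := ih hc.2 hc₂.2 (Prod.ext rfl h.2) (Prod.ext h3.2 h₂.2)
      rw [h4, h5, h3.1]
      exact ⟨rfl, rfl⟩

lemma bumpColumn_lt_bumpColumn {x y x' y' : ℕ} {c c' c'' : List ℕ} (hc : c.Pairwise (· < ·))
    (hxy : x < y) (h : bumpColumn x c = (c', some x')) (h' : bumpColumn y c' = (c'', some y')) :
    x' < y' := by
  induction c generalizing c' c'' with
  | nil => simp [bumpColumn] at h
  | cons a c ih =>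
    rw [List.pairwise_cons] at hc
    rcases le_or_gt x a with hx | hx
    · rw [bumpColumn_cons_of_le c hx, Prod.mk.injEq, Option.some_inj] at h
      obtain ⟨rfl, rfl⟩ := h
      rw [bumpColumn_cons_of_lt c hxy, Prod.mk.injEq] at h'
      -- All entries of `c` exceed `a`, so only `y' = y` needs an argument: `y' ≤ a` would make the
      -- bottom entry of `c`, larger than `a`, the bumped one.
      rcases (mem_bumpColumn y c y').1 (Or.inr h'.2) with h1 | h1
      · subst h1
        by_contra hcon
        have h2 : bumpColumn y' c = ((bumpColumn y' c).1, some y') := Prod.ext rfl h'.2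
        rcases c with _ | ⟨e, c⟩
        · simp [bumpColumn] at h2
        · have he := hc.1 e (by simp)
          rw [bumpColumn_cons_of_le c (by omega), Prod.mk.injEq, Option.some_inj] at h2
          omega
      · exact hc.1 y' h1
    · rw [bumpColumn_cons_of_lt c hx, Prod.mk.injEq] at h
      obtain ⟨rfl, h⟩ := h
      rw [bumpColumn_cons_of_lt _ (hx.trans hxy), Prod.mk.injEq] at h'
      exact ih hc.2 (Prod.ext rfl h) (Prod.ext rfl h'.2)

/-- Since `x` is now in the column, `y ≤ x` must bump `x` or an entry below it, hence something `≤ x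
≤ x'`. -/
lemma bumpColumn_le_bumpColumn {x y x' : ℕ} {c c' : List ℕ}
    (hxy : y ≤ x) (h : bumpColumn x c = (c', some x')) :
    ∃ c'' y', bumpColumn y c' = (c'', some y') ∧ y' ≤ x' := by
  induction c generalizing c' with
  | nil => simp [bumpColumn] at h
  | cons a c ih =>
    have hx' := le_of_bumpColumn h
    rcases le_or_gt x a with hx | hx
    · rw [bumpColumn_cons_of_le c hx, Prod.mk.injEq, Option.some_inj] at h
      obtain ⟨rfl, rfl⟩ := h
      exact ⟨_, _, bumpColumn_cons_of_le c hxy, hx⟩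
    · rw [bumpColumn_cons_of_lt c hx, Prod.mk.injEq] at h
      obtain ⟨rfl, h⟩ := h
      rcases le_or_gt y a with hy | hy
      · exact ⟨_, _, bumpColumn_cons_of_le _ hy, by omega⟩
      · obtain ⟨c'', y', h1, h2⟩ := ih (Prod.ext rfl h)
        exact ⟨_, _, (bumpColumn_cons_of_lt _ hy).trans (by rw [h1]), h2⟩

/-! ### Column insertion into a tableau -/

/-- A list of nonempty columns forms a Young tableau. -/
def IsColumnTableau : List (List ℕ) → Prop
  | [] => True
  | c :: cs => c ≠ [] ∧ c.Pairwise (· < ·) ∧ Dom c (cs.headD []) ∧ IsColumnTableau cs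

lemma isColumnTableau_cons {c : List ℕ} {cs : List (List ℕ)} :
    IsColumnTableau (c :: cs) ↔
      c ≠ [] ∧ c.Pairwise (· < ·) ∧ Dom c (cs.headD []) ∧ IsColumnTableau cs := Iff.rfl

lemma IsColumnTableau.headD_pairwise {P : List (List ℕ)} (h : IsColumnTableau P) :
    (P.headD []).Pairwise (· < ·) := by
  cases P with
  | nil => simp
  | cons c cs => exact h.2.1

lemma columnInsert_cons_none {x : ℕ} {c c' : List ℕ} (cs : List (List ℕ))
    (h : bumpColumn x c = (c', none)) :
    columnInsert x (c :: cs) = (c' :: cs, (c.length, 0)) := by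
  simp [columnInsert, h]

lemma columnInsert_cons_some {x y : ℕ} {c c' : List ℕ} (cs : List (List ℕ))
    (h : bumpColumn x c = (c', some y)) :
    columnInsert x (c :: cs) = (c' :: (columnInsert y cs).1,
        ((columnInsert y cs).2.1, (columnInsert y cs).2.2 + 1)) := by
  simp [columnInsert, h]

/-- Opening a new column is a bump into the empty column, so the right edge of the tableau needs no
separate treatment. -/
lemma headD_columnInsert (x : ℕ) (P : List (List ℕ)) :
    (columnInsert x P).1.headD [] = (bumpColumn x (P.headD [])).1 := by
  cases P with
  | nil => rfl
  | cons c cs =>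
    rcases h : bumpColumn x c with ⟨c', _ | y⟩
    · simp [columnInsert_cons_none cs h, h]
    · simp [columnInsert_cons_some cs h, h]

/-- The length of the `j`-th column of a list of columns. -/
def columnLength (P : List (List ℕ)) (j : ℕ) : ℕ := (P.getD j []).length

@[simp] lemma columnLength_nil (j : ℕ) : columnLength [] j = 0 := by simp [columnLength]

@[simp] lemma columnLength_cons_zero (c : List ℕ) (P : List (List ℕ)) :
    columnLength (c :: P) 0 = c.length := rfl

@[simp] lemma columnLength_cons_succ (c : List ℕ) (P : List (List ℕ)) (j : ℕ) :
    columnLength (c :: P) (j + 1) = columnLength P j := by simp [columnLength]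

lemma length_headD (P : List (List ℕ)) : (P.headD []).length = columnLength P 0 := by
  cases P <;> simp

lemma IsColumnTableau.columnLength_succ_le {P : List (List ℕ)} (h : IsColumnTableau P) (j : ℕ) :
    columnLength P (j + 1) ≤ columnLength P j := by
  induction P generalizing j with
  | nil => simp
  | cons c cs ih =>
    cases j with
    | zero => simpa [← length_headD] using h.2.2.1.length_le
    | succ j => simpa using ih h.2.2.2 j

lemma IsColumnTableau.columnLength_antitone {P : List (List ℕ)} (h : IsColumnTableau P) :
    Antitone (columnLength P) :=
  antitone_nat_of_succ_le h.columnLength_succ_le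

lemma IsColumnTableau.columnInsert {P : List (List ℕ)} (h : IsColumnTableau P) (x : ℕ) :
    IsColumnTableau (columnInsert x P).1 := by
  induction P generalizing x with
  | nil => simp [SquareTableaux.columnInsert, IsColumnTableau]
  | cons c cs ih =>
    rw [isColumnTableau_cons] at h
    have hs := bumpColumn_pairwise x h.2.1
    rcases hb : bumpColumn x c with ⟨c', _ | y⟩
    · rw [columnInsert_cons_none cs hb, isColumnTableau_cons]
      rw [hb] at hs
      obtain ⟨rfl, -⟩ := bumpColumn_none hb
      refine ⟨by simp, hs, ?_, h.2.2.2⟩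
      have := h.2.2.1
      rw [dom_iff] at this ⊢
      refine ⟨by rw [List.length_append]; omega, fun i hi => ?_⟩
      have h2 := this.2 i hi
      rwa [List.getD_append _ _ _ _ (by omega)]
    · rw [columnInsert_cons_some cs hb, isColumnTableau_cons]
      rw [hb] at hs
      refine ⟨?_, hs, ?_, ih h.2.2.2 y⟩
      · have := bumpColumn_length hb
        rw [← List.length_pos_iff, this, List.length_pos_iff]
        exact h.1
      · simp only [headD_columnInsert]
        exact h.2.2.1.bumpColumn hb

lemma columnInsert_box (x : ℕ) (P : List (List ℕ)) :
    (columnInsert x P).2.1 = columnLength P (columnInsert x P).2.2 := by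
  induction P generalizing x with
  | nil => simp [columnInsert]
  | cons c cs ih =>
    rcases hb : bumpColumn x c with ⟨c', _ | y⟩
    · simp [columnInsert_cons_none cs hb]
    · simp [columnInsert_cons_some cs hb, ih]

lemma columnLength_columnInsert (x : ℕ) (P : List (List ℕ)) (j : ℕ) :
    columnLength (columnInsert x P).1 j =
      columnLength P j + if j = (columnInsert x P).2.2 then 1 else 0 := by
  induction P generalizing x j with
  | nil => cases j <;> simp [columnInsert]
  | cons c cs ih =>
    rcases hb : bumpColumn x c with ⟨c', _ | y⟩
    · rw [columnInsert_cons_none cs hb]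
      cases j <;> simp [(bumpColumn_none hb).1]
    · rw [columnInsert_cons_some cs hb]
      cases j <;> simp [ih, bumpColumn_length hb]

lemma mem_columnInsert (x : ℕ) (P : List (List ℕ)) (z : ℕ) :
    z ∈ (columnInsert x P).1.flatten ↔ z = x ∨ z ∈ P.flatten := by
  induction P generalizing x with
  | nil => simp [columnInsert]
  | cons c cs ih =>
    have := mem_bumpColumn x c z
    rcases hb : bumpColumn x c with ⟨c', _ | y⟩
    · rw [columnInsert_cons_none cs hb]
      rw [hb] at this
      simp only [List.flatten_cons, List.mem_append] at this ⊢
      simp at this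
      tauto
    · rw [columnInsert_cons_some cs hb]
      rw [hb] at this
      simp only [List.flatten_cons, List.mem_append, ih, Option.some_inj] at this ⊢
      rw [eq_comm (a := z) (b := y)]
      tauto

/-- The column index of the new box tells whether the first column grew or bumped an entry, so both
insertions follow the same alternative in every column. Nonemptiness of columns excludes confusing a
new column with an old one. -/
lemma columnInsert_inj {x x₂ : ℕ} {P P₂ : List (List ℕ)} (hP : IsColumnTableau P)
    (hP₂ : IsColumnTableau P₂) (h : columnInsert x P = columnInsert x₂ P₂) :
    x = x₂ ∧ P = P₂ := by
  induction P generalizing x x₂ P₂ with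
  | nil =>
    rcases P₂ with _ | ⟨c₂, cs₂⟩
    · simp [columnInsert] at h; simp [h]
    · rcases hb : bumpColumn x₂ c₂ with ⟨c', _ | y⟩
      · rw [columnInsert_cons_none cs₂ hb] at h
        simp only [columnInsert, Prod.mk.injEq] at h
        exact absurd (List.eq_nil_of_length_eq_zero h.2.1.symm) hP₂.1
      · rw [columnInsert_cons_some cs₂ hb] at h
        simp [columnInsert] at h
  | cons c cs ih =>
    rw [isColumnTableau_cons] at hP
    rcases P₂ with _ | ⟨c₂, cs₂⟩
    · rcases hb : bumpColumn x c with ⟨c', _ | y⟩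
      · rw [columnInsert_cons_none cs hb] at h
        simp only [columnInsert, Prod.mk.injEq] at h
        exact absurd (List.eq_nil_of_length_eq_zero h.2.1) hP.1
      · rw [columnInsert_cons_some cs hb] at h
        simp [columnInsert] at h
    rw [isColumnTableau_cons] at hP₂
    rcases hb : bumpColumn x c with ⟨c', _ | y⟩ <;>
      rcases hb₂ : bumpColumn x₂ c₂ with ⟨c₂', _ | y₂⟩
    · rw [columnInsert_cons_none cs hb, columnInsert_cons_none cs₂ hb₂] at h
      simp only [Prod.mk.injEq, List.cons.injEq] at h
      obtain ⟨⟨h1, rfl⟩, -⟩ := h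
      rw [(bumpColumn_none hb).1, (bumpColumn_none hb₂).1] at h1
      have := List.append_inj' h1 rfl
      simp_all
    · rw [columnInsert_cons_none cs hb, columnInsert_cons_some cs₂ hb₂] at h
      simp at h
    · rw [columnInsert_cons_some cs hb, columnInsert_cons_none cs₂ hb₂] at h
      simp at h
    · rw [columnInsert_cons_some cs hb, columnInsert_cons_some cs₂ hb₂] at h
      simp only [Prod.mk.injEq, List.cons.injEq, add_left_inj] at h
      obtain ⟨⟨rfl, h1⟩, h2, h3⟩ := h
      obtain ⟨rfl, rfl⟩ := ih hP.2.2.2 hP₂.2.2.2 (Prod.ext h1 (Prod.ext h2 h3))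
      obtain ⟨rfl, rfl⟩ := bumpColumn_inj hP.2.1 hP₂.2.1 hb hb₂
      exact ⟨rfl, rfl⟩

/-- Reverse column insertion, starting from a corner of the tableau. -/
lemma exists_columnInsert_eq {P' : List (List ℕ)} (hP : IsColumnTableau P') {r k : ℕ}
    (h1 : columnLength P' k = r + 1) (h2 : columnLength P' (k + 1) ≤ r) :
    ∃ x P, IsColumnTableau P ∧ columnInsert x P = (P', (r, k)) := by
  induction k generalizing P' with
  | zero =>
    rcases P' with _ | ⟨c', cs⟩
    · simp at h1
    rw [isColumnTableau_cons] at hP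
    obtain ⟨-, hs, hd, hcs⟩ := hP
    rw [columnLength_cons_zero] at h1
    rw [columnLength_cons_succ] at h2
    obtain ⟨c, x, rfl⟩ : ∃ c x, c' = c ++ [x] :=
      ⟨c'.dropLast, c'.getLast (by rintro rfl; simp at h1), (List.dropLast_append_getLast _).symm⟩
    simp only [List.length_append, List.length_singleton, add_left_inj] at h1
    rw [List.pairwise_append] at hs
    have hlt : ∀ z ∈ c, z < x := fun z hz => hs.2.2 z hz x (by simp)
    -- Columns are nonempty, so removing a one-box column has to leave the list `[]` and not `[[]]`.
    rcases eq_or_ne c [] with rfl | hc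
    · obtain rfl : cs = [] := by
        rcases cs with _ | ⟨d, cs⟩
        · rfl
        · exfalso
          simp at h1
          simp [← h1] at h2
          exact hcs.1 h2
      refine ⟨x, [], trivial, ?_⟩
      simp at h1
      simp [columnInsert, ← h1]
    · refine ⟨x, c :: cs, ⟨hc, hs.1, ?_, hcs⟩, ?_⟩
      · rw [dom_iff] at hd ⊢
        rw [length_headD] at hd ⊢
        refine ⟨by omega, fun i hi => ?_⟩
        have := hd.2 i hi
        rwa [List.getD_append _ _ _ _ (by omega)] at this
      · rw [columnInsert_cons_none cs (bumpColumn_of_forall_lt hlt), h1]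
  | succ k ih =>
    rcases P' with _ | ⟨c', cs'⟩
    · simp at h1
    rw [isColumnTableau_cons] at hP
    obtain ⟨hne, hs, hd, hcs⟩ := hP
    simp only [columnLength_cons_succ] at h1 h2
    obtain ⟨y, cs, hcs', hins⟩ := ih hcs h1 h2
    rcases c' with _ | ⟨a, c'⟩
    · exact absurd rfl hne
    have hhead : cs'.headD [] = (bumpColumn y (cs.headD [])).1 := by
      rw [← headD_columnInsert, hins]
    rw [hhead] at hd
    -- Reverse bumping of `y` requires this: `y` lies in the next column, whose bottom entry is at
    -- least `a`.
    have hay : a ≤ y := by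
      have hmem := mem_bumpColumn_self y (cs.headD [])
      have hsort := bumpColumn_pairwise y hcs'.headD_pairwise
      rcases hl : (bumpColumn y (cs.headD [])).1 with _ | ⟨b, d⟩
      · rw [hl] at hmem; simp at hmem
      · rw [hl] at hmem hd hsort
        rw [List.pairwise_cons] at hsort
        rw [List.mem_cons] at hmem
        have := hd.1
        rcases hmem with rfl | hmem
        · exact this
        · have := hsort.1 y hmem; omega
    obtain ⟨x, c, -, hc, hb⟩ := exists_bumpColumn_eq hs hay
    refine ⟨x, c :: cs, ⟨?_, hc, Dom.of_bumpColumn hc hcs'.headD_pairwise hb hd, hcs'⟩, ?_⟩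
    · rintro rfl
      simp [bumpColumn] at hb
    · rw [columnInsert_cons_some cs hb, hins]

/-! ### Rows of the boxes created by two successive insertions. -/

lemma IsColumnTableau.columnInsert_fst_lt {P : List (List ℕ)} (h : IsColumnTableau P) (x : ℕ)
    {j : ℕ} (hj : j ≤ (SquareTableaux.columnInsert x P).2.2) :
    (SquareTableaux.columnInsert x P).2.1 <
      columnLength (SquareTableaux.columnInsert x P).1 j := by
  refine lt_of_lt_of_le ?_ ((h.columnInsert x).columnLength_antitone hj)
  rw [columnLength_columnInsert, columnInsert_box]
  simp

/-- The bumped entries stay strictly ordered from column to column, so the second insertion stops no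
further right than the first. The column where it stops already reaches the row of the first new
box, and it adds a box on top. -/
lemma columnInsert_row_lt {x y : ℕ} {P : List (List ℕ)} (hP : IsColumnTableau P) (hxy : x < y) :
    (columnInsert x P).2.1 < (columnInsert y (columnInsert x P).1).2.1 := by
  induction P generalizing x y with
  | nil => simp [columnInsert, bumpColumn, hxy.not_ge]
  | cons c cs ih =>
    have hrow := hP.columnInsert_fst_lt x (Nat.zero_le _)
    rw [isColumnTableau_cons] at hP
    rcases hb : bumpColumn x c with ⟨c', _ | x'⟩
    · rw [columnInsert_cons_none cs hb]
      obtain ⟨rfl, hlt⟩ := bumpColumn_none hb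
      have : bumpColumn y (c ++ [x]) = (c ++ [x] ++ [y], none) := by
        refine bumpColumn_of_forall_lt fun z hz => ?_
        simp only [List.mem_append, List.mem_singleton] at hz
        rcases hz with hz | rfl
        · exact (hlt z hz).trans hxy
        · exact hxy
      rw [columnInsert_cons_none cs this]
      simp
    · rw [columnInsert_cons_some cs hb] at hrow ⊢
      rcases hb' : bumpColumn y c' with ⟨c'', _ | y'⟩
      · rw [columnInsert_cons_none _ hb']
        simpa using hrow
      · rw [columnInsert_cons_some _ hb']
        exact ih hP.2.2.2 (bumpColumn_lt_bumpColumn hP.2.1 hxy hb hb')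

/-- Here the second insertion still bumps in the column where the first one stopped. It ends further
right, where columns are no higher. -/
lemma columnInsert_row_le {x y : ℕ} {P : List (List ℕ)} (hP : IsColumnTableau P) (hxy : y ≤ x) :
    (columnInsert y (columnInsert x P).1).2.1 ≤ (columnInsert x P).2.1 := by
  induction P generalizing x y with
  | nil => simp [columnInsert, bumpColumn, hxy]
  | cons c cs ih =>
    have hrow := (hP.columnInsert x).columnInsert_fst_lt y (Nat.zero_le _)
    rw [isColumnTableau_cons] at hP
    rcases hb : bumpColumn x c with ⟨c', _ | x'⟩
    · rw [columnInsert_cons_none cs hb] at hrow ⊢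
      obtain ⟨rfl, hlt⟩ := bumpColumn_none hb
      rcases hb' : bumpColumn y (c ++ [x]) with ⟨c'', _ | y'⟩
      · have := (bumpColumn_none hb').2 x (by simp)
        omega
      · have hl := bumpColumn_length hb'
        rw [columnInsert_cons_some cs hb'] at hrow ⊢
        simp at hl hrow ⊢
        omega
    · rw [columnInsert_cons_some cs hb]
      obtain ⟨c'', y', hb', hle⟩ := bumpColumn_le_bumpColumn hxy hb
      rw [columnInsert_cons_some _ hb']
      exact ih hP.2.2.2 hle

/-! ### Tableaux as lists of columns and as fillings -/

lemma isYoungTableau_iff {N : ℕ} {μ : YoungDiagram} {T : ℕ → ℕ → ℕ} :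
    IsYoungTableau N μ T ↔
      (∀ i j₁ j₂, j₁ < j₂ → (i, j₂) ∈ μ → T i j₁ ≤ T i j₂) ∧
      (∀ i₁ i₂ j, i₁ < i₂ → (i₂, j) ∈ μ → T i₁ j < T i₂ j) ∧
      (∀ i j, (i, j) ∉ μ → T i j = 0) ∧
      ∀ i j, (i, j) ∈ μ → 1 ≤ T i j ∧ T i j ≤ N := by
  constructor
  · rintro ⟨S, hS, hr⟩
    simp only [← hS]
    exact ⟨fun _ _ _ => S.row_weak, fun _ _ _ => S.col_strict, fun _ _ => S.zeros, hr⟩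
  · rintro ⟨h1, h2, h3, h4⟩
    exact ⟨⟨T, h1 _ _ _, h2 _ _ _, h3 _ _⟩, fun _ _ => rfl, h4⟩

lemma isColumnTableau_iff {P : List (List ℕ)} :
    IsColumnTableau P ↔ (∀ c ∈ P, c ≠ [] ∧ c.Pairwise (· < ·)) ∧
      ∀ j, Dom (P.getD j []) (P.getD (j + 1) []) := by
  induction P with
  | nil => simp [IsColumnTableau]
  | cons c cs ih =>
    rw [isColumnTableau_cons, ih]
    have hd : cs.headD [] = cs.getD 0 [] := by cases cs <;> simp
    constructor
    · rintro ⟨h1, h2, h3, h4, h5⟩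
      refine ⟨?_, fun j => ?_⟩
      · simp only [List.mem_cons, forall_eq_or_imp]
        exact ⟨⟨h1, h2⟩, h4⟩
      · cases j with
        | zero => rw [hd] at h3; simpa using h3
        | succ j => simpa using h5 j
    · rintro ⟨h1, h2⟩
      simp only [List.mem_cons, forall_eq_or_imp] at h1
      refine ⟨h1.1.1, h1.1.2, ?_, h1.2, fun j => by simpa using h2 (j + 1)⟩
      rw [hd]
      simpa using h2 0

lemma getD_mem_of_lt {c : List ℕ} {i : ℕ} (h : i < c.length) : c.getD i 0 ∈ c := by
  rw [List.getD_eq_getElem _ _ h]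
  exact List.getElem_mem h

lemma mem_flatten_iff_filling {P : List (List ℕ)} {z : ℕ} :
    z ∈ P.flatten ↔ ∃ i j, i < columnLength P j ∧ fillingOfColumns P i j = z := by
  constructor
  · intro h
    obtain ⟨c, hc, hz⟩ := List.mem_flatten.1 h
    obtain ⟨j, hj, rfl⟩ := List.getElem_of_mem hc
    obtain ⟨i, hi, rfl⟩ := List.getElem_of_mem hz
    refine ⟨i, j, ?_, ?_⟩
    · simpa [columnLength, List.getElem?_eq_getElem hj] using hi
    · simp [fillingOfColumns, List.getElem?_eq_getElem hj, List.getElem?_eq_getElem hi]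
  · rintro ⟨i, j, hi, rfl⟩
    have hj : j < P.length := by
      by_contra h
      rw [columnLength, List.getD_eq_default _ _ (by omega)] at hi
      simp at hi
    refine List.mem_flatten.2 ⟨P.getD j [], ?_, getD_mem_of_lt hi⟩
    rw [List.getD_eq_getElem _ _ hj]
    exact List.getElem_mem hj

lemma filling_eq_zero {P : List (List ℕ)} {i j : ℕ} (h : columnLength P j ≤ i) :
    fillingOfColumns P i j = 0 :=
  List.getD_eq_default _ _ h

lemma columnLength_eq_zero {P : List (List ℕ)} {j : ℕ} (h : P.length ≤ j) :
    columnLength P j = 0 := by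
  rw [columnLength, List.getD_eq_default _ _ h]
  rfl

/-- The shape of a list of columns forming a tableau. -/
def columnShape (P : List (List ℕ)) (hP : IsColumnTableau P) : YoungDiagram where
  cells := (Finset.range (columnLength P 0) ×ˢ Finset.range P.length).filter
    (fun b => b.1 < columnLength P b.2)
  isLowerSet := by
    rintro ⟨a, b⟩ ⟨c, d⟩ hle h
    have h1 : c ≤ a := hle.1
    have h2 : d ≤ b := hle.2
    simp only [Finset.coe_filter, Finset.mem_product, Finset.mem_range, Set.mem_ofPred_eq] at h ⊢
    have := hP.columnLength_antitone h2
    exact ⟨⟨by omega, by omega⟩, by omega⟩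

lemma mem_columnShape {P : List (List ℕ)} {hP : IsColumnTableau P} {i j : ℕ} :
    (i, j) ∈ columnShape P hP ↔ i < columnLength P j := by
  rw [← YoungDiagram.mem_cells]
  simp only [columnShape, Finset.mem_filter, Finset.mem_product, Finset.mem_range,
    and_iff_right_iff_imp]
  intro h
  refine ⟨h.trans_le (hP.columnLength_antitone (Nat.zero_le j)), ?_⟩
  by_contra hj
  rw [columnLength_eq_zero (by omega)] at h
  omega

lemma IsColumnTableau.filling_succ_le {P : List (List ℕ)} (hP : IsColumnTableau P) {i j : ℕ}
    (h : i < columnLength P (j + 1)) : fillingOfColumns P i j ≤ fillingOfColumns P i (j + 1) :=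
  (dom_iff.1 ((isColumnTableau_iff.1 hP).2 j)).2 i h

lemma IsColumnTableau.filling_row_le {P : List (List ℕ)} (hP : IsColumnTableau P) {i j₁ j₂ : ℕ}
    (hj : j₁ ≤ j₂) (h : i < columnLength P j₂) :
    fillingOfColumns P i j₁ ≤ fillingOfColumns P i j₂ := by
  induction j₂, hj using Nat.le_induction with
  | base => rfl
  | succ n hn ih =>
    exact (ih (h.trans_le (hP.columnLength_succ_le n))).trans (hP.filling_succ_le h)

lemma IsColumnTableau.filling_col_lt {P : List (List ℕ)} (hP : IsColumnTableau P) {i₁ i₂ j : ℕ}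
    (hi : i₁ < i₂) (h : i₂ < columnLength P j) :
    fillingOfColumns P i₁ j < fillingOfColumns P i₂ j := by
  have hj : j < P.length := by
    by_contra hj
    rw [columnLength_eq_zero (by omega)] at h
    omega
  have hs := ((isColumnTableau_iff.1 hP).1 P[j] (List.getElem_mem hj)).2
  have hg : P.getD j [] = P[j] := List.getD_eq_getElem _ _ hj
  rw [columnLength, hg] at h
  rw [fillingOfColumns, fillingOfColumns, hg, List.getD_eq_getElem _ _ h,
    List.getD_eq_getElem _ _ (hi.trans h)]
  exact List.pairwise_iff_getElem.1 hs _ _ _ _ hi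

lemma isYoungTableau_fillingOfColumns {N : ℕ} {P : List (List ℕ)} (hP : IsColumnTableau P)
    (hN : ∀ z ∈ P.flatten, 1 ≤ z ∧ z ≤ N) :
    IsYoungTableau N (columnShape P hP) (fillingOfColumns P) := by
  rw [isYoungTableau_iff]
  simp only [mem_columnShape]
  exact ⟨fun i j₁ j₂ h => hP.filling_row_le h.le, fun i₁ i₂ j h => hP.filling_col_lt h,
    fun i j h => filling_eq_zero (not_lt.1 h),
    fun i j h => hN _ (mem_flatten_iff_filling.2 ⟨i, j, h, rfl⟩)⟩

lemma exists_columns_of_isYoungTableau {N : ℕ} {μ : YoungDiagram} {T : ℕ → ℕ → ℕ}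
    (h : IsYoungTableau N μ T) :
    ∃ P, IsColumnTableau P ∧ fillingOfColumns P = T ∧ (∀ z ∈ P.flatten, 1 ≤ z ∧ z ≤ N) ∧
      ∀ j, columnLength P j = μ.colLen j := by
  obtain ⟨hrow, hcol, hzero, hrange⟩ := isYoungTableau_iff.1 h
  set P : List (List ℕ) := (List.range (μ.rowLen 0)).map fun j =>
    (List.range (μ.colLen j)).map fun i => T i j with hPdef
  have hget : ∀ j, P.getD j [] = (List.range (μ.colLen j)).map fun i => T i j := by
    intro j
    rcases lt_or_ge j (μ.rowLen 0) with hj | hj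
    · rw [List.getD_eq_getElem _ _ (by simpa [hPdef] using hj)]
      simp [hPdef]
    · rw [List.getD_eq_default _ _ (by simpa [hPdef] using hj)]
      have : μ.colLen j = 0 := by
        by_contra hne
        have := YoungDiagram.mem_iff_lt_rowLen.1
          (YoungDiagram.mem_iff_lt_colLen.2 (Nat.pos_of_ne_zero hne))
        omega
      simp [this]
  have hlen : ∀ j, columnLength P j = μ.colLen j := fun j => by
    rw [columnLength, hget]; simp
  have hfill : ∀ i j, i < μ.colLen j → fillingOfColumns P i j = T i j := by
    intro i j hi
    rw [fillingOfColumns, hget, List.getD_eq_getElem _ _ (by simpa using hi)]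
    simp
  refine ⟨P, ?_, ?_, ?_, hlen⟩
  · rw [isColumnTableau_iff]
    constructor
    · simp only [hPdef, List.mem_map, List.mem_range, forall_exists_index, and_imp,
        forall_apply_eq_imp_iff₂]
      intro j hj
      constructor
      · have := YoungDiagram.mem_iff_lt_colLen.1 (YoungDiagram.mem_iff_lt_rowLen.2 hj)
        simp
        omega
      · rw [List.pairwise_map]
        refine List.pairwise_lt_range.imp_of_mem fun {a b} _ hb hab => ?_
        exact hcol a b j hab (YoungDiagram.mem_iff_lt_colLen.2 (List.mem_range.1 hb))
    · intro j
      rw [dom_iff]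
      have hanti := μ.colLen_anti j (j + 1) (by omega)
      refine ⟨by simpa only [hget, List.length_map, List.length_range] using hanti,
        fun i hi => ?_⟩
      have hi' : i < μ.colLen (j + 1) := by rwa [hget, List.length_map, List.length_range] at hi
      have e1 := hfill i j (by omega)
      have e2 := hfill i (j + 1) hi'
      rw [fillingOfColumns] at e1 e2
      rw [e1, e2]
      exact hrow i j (j + 1) (by omega) (YoungDiagram.mem_iff_lt_colLen.2 hi')
  · funext i j
    rcases lt_or_ge i (μ.colLen j) with hi | hi
    · exact hfill i j hi
    · rw [filling_eq_zero (by rw [hlen]; exact hi), hzero]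
      rw [YoungDiagram.mem_iff_lt_colLen]
      omega
  · intro z hz
    obtain ⟨i, j, hi, rfl⟩ := mem_flatten_iff_filling.1 hz
    rw [hlen] at hi
    rw [hfill i j hi]
    exact hrange i j (YoungDiagram.mem_iff_lt_colLen.2 hi)

/-- Entries are positive, so the default value `0` marks the end of a list. -/
lemma eq_of_getD_eq {c d : List ℕ} (hc : ∀ z ∈ c, 1 ≤ z) (hd : ∀ z ∈ d, 1 ≤ z)
    (h : ∀ i, c.getD i 0 = d.getD i 0) : c = d := by
  have aux : ∀ {c d : List ℕ}, (∀ z ∈ c, 1 ≤ z) → (∀ i, c.getD i 0 = d.getD i 0) →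
      c.length ≤ d.length := by
    intro c d hc h
    by_contra hlt
    have h1 := hc _ (getD_mem_of_lt (not_le.1 hlt))
    rw [h, List.getD_eq_default _ _ le_rfl] at h1
    omega
  refine List.ext_getElem (le_antisymm (aux hc h) (aux hd fun i => (h i).symm)) fun i h1 h2 => ?_
  simpa [List.getElem?_eq_getElem h1, List.getElem?_eq_getElem h2] using h i

lemma fillingOfColumns_inj {P P' : List (List ℕ)} (hP : IsColumnTableau P)
    (hP' : IsColumnTableau P') (h1 : ∀ z ∈ P.flatten, 1 ≤ z) (h1' : ∀ z ∈ P'.flatten, 1 ≤ z)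
    (h : fillingOfColumns P = fillingOfColumns P') : P = P' := by
  have key : ∀ j, P.getD j [] = P'.getD j [] := by
    have hmem : ∀ (R : List (List ℕ)) (j z : ℕ), z ∈ R.getD j [] → z ∈ R.flatten := by
      intro R j z hz
      rcases lt_or_ge j R.length with hj | hj
      · rw [List.getD_eq_getElem _ _ hj] at hz
        exact List.mem_flatten.2 ⟨_, List.getElem_mem hj, hz⟩
      · rw [List.getD_eq_default _ _ hj] at hz
        simp at hz
    exact fun j => eq_of_getD_eq (fun z hz => h1 z (hmem _ _ _ hz))
      (fun z hz => h1' z (hmem _ _ _ hz)) fun i => congrFun (congrFun h i) j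
  have aux : ∀ {P P' : List (List ℕ)}, IsColumnTableau P → (∀ j, P.getD j [] = P'.getD j []) →
      P.length ≤ P'.length := by
    intro P P' hP h
    by_contra hlt
    rw [not_le] at hlt
    have := h P'.length
    rw [List.getD_eq_default P' _ le_rfl, List.getD_eq_getElem _ _ hlt] at this
    exact ((isColumnTableau_iff.1 hP).1 _ (List.getElem_mem hlt)).1 this
  refine List.ext_getElem (le_antisymm (aux hP key) (aux hP' fun i => (key i).symm))
    fun i h1 h2 => ?_
  simpa [List.getElem?_eq_getElem h1, List.getElem?_eq_getElem h2] using key i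

/-! ### Pairs of tableaux of conjugate shapes -/

/-- The columns `P` and the filling `Q` form a pair of tableaux of conjugate shapes, with entries
in `{1, …, N}`. -/
structure IsKnuthPair (N : ℕ) (s : List (List ℕ) × (ℕ → ℕ → ℕ)) : Prop where
  columns : IsColumnTableau s.1
  mem_range : ∀ z ∈ s.1.flatten, 1 ≤ z ∧ z ≤ N
  zeros : ∀ i j, columnLength s.1 i ≤ j → s.2 i j = 0
  range : ∀ i j, j < columnLength s.1 i → 1 ≤ s.2 i j ∧ s.2 i j ≤ N
  row_weak : ∀ i j₁ j₂, j₁ < j₂ → j₂ < columnLength s.1 i → s.2 i j₁ ≤ s.2 i j₂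
  col_strict : ∀ i₁ i₂ j, i₁ < i₂ → j < columnLength s.1 i₂ → s.2 i₁ j < s.2 i₂ j

lemma isKnuthPair_nil (N : ℕ) : IsKnuthPair N ([], fun _ _ => 0) := by
  constructor <;> simp [IsColumnTableau]

/-- The conjugate of the box `b` carries the rightmost occurrence of the largest entry `u` of the
filling `Q`. -/
def IsLastBox (Q : ℕ → ℕ → ℕ) (b : ℕ × ℕ) (u : ℕ) : Prop :=
  Q b.2 b.1 = u ∧ ∀ i j, Q i j ≤ u ∧ (Q i j = u → j ≤ b.1)

lemma IsKnuthPair.lt_columnLength {N : ℕ} {s : List (List ℕ) × (ℕ → ℕ → ℕ)}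
    (h : IsKnuthPair N s) {i j : ℕ} (hne : s.2 i j ≠ 0) : j < columnLength s.1 i := by
  by_contra hlt
  exact hne (h.zeros i j (not_lt.1 hlt))

lemma IsKnuthPair.col_inj {N : ℕ} {s : List (List ℕ) × (ℕ → ℕ → ℕ)} (h : IsKnuthPair N s)
    {i₁ i₂ j : ℕ} (hne : s.2 i₁ j ≠ 0) (heq : s.2 i₁ j = s.2 i₂ j) : i₁ = i₂ := by
  rcases lt_trichotomy i₁ i₂ with hlt | rfl | hlt
  · have := h.col_strict _ _ j hlt (h.lt_columnLength (heq ▸ hne))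
    omega
  · rfl
  · have := h.col_strict _ _ j hlt (h.lt_columnLength hne)
    omega

/-- The filling determines its largest entry and the column of the rightmost occurrence; strictness
of that column determines the row. -/
lemma IsLastBox.unique {N : ℕ} {s : List (List ℕ) × (ℕ → ℕ → ℕ)} (h : IsKnuthPair N s)
    {b b' : ℕ × ℕ} {u u' : ℕ} (hu : u ≠ 0) (hb : IsLastBox s.2 b u) (hb' : IsLastBox s.2 b' u') :
    b = b' ∧ u = u' := by
  have e : u = u' := by
    refine le_antisymm ?_ ?_
    · rw [← hb.1]; exact (hb'.2 _ _).1
    · rw [← hb'.1]; exact (hb.2 _ _).1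
  subst e
  have e1 : b.1 = b'.1 := le_antisymm ((hb'.2 _ _).2 hb.1) ((hb.2 _ _).2 hb'.1)
  refine ⟨Prod.ext e1 (h.col_inj (j := b.1) ?_ ?_), rfl⟩
  · rw [hb.1]; exact hu
  · rw [hb.1, e1, hb'.1]

lemma knuthStep_snd (s : List (List ℕ) × (ℕ → ℕ → ℕ)) (p : ℕ × ℕ) (i j : ℕ) :
    (knuthStep s p).2 i j = if (j, i) = (columnInsert p.2 s.1).2 then p.1 else s.2 i j := rfl

/-- By `hmax`, the earlier occurrences of `p.1` stand strictly to the left of its new place; this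
keeps the columns of the second filling strict. -/
lemma isKnuthPair_knuthStep {N : ℕ} {s : List (List ℕ) × (ℕ → ℕ → ℕ)} (h : IsKnuthPair N s)
    {p : ℕ × ℕ} (h1 : 1 ≤ p.1 ∧ p.1 ≤ N) (h2 : 1 ≤ p.2 ∧ p.2 ≤ N)
    (hmax : ∀ i j, s.2 i j ≤ p.1 ∧ (s.2 i j = p.1 → j < (columnInsert p.2 s.1).2.1)) :
    IsKnuthPair N (knuthStep s p) ∧
      IsLastBox (knuthStep s p).2 (columnInsert p.2 s.1).2 p.1 := by
  obtain ⟨P, Q⟩ := s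
  obtain ⟨u, v⟩ := p
  have hlen := columnLength_columnInsert v P
  have hbox := columnInsert_box v P
  have htab := h.columns.columnInsert v
  have hmem := mem_columnInsert v P
  have hQ : ∀ i j, (knuthStep (P, Q) (u, v)).2 i j =
      if (j, i) = (columnInsert v P).2 then u else Q i j := fun _ _ => rfl
  have hPs : (knuthStep (P, Q) (u, v)).1 = (columnInsert v P).1 := rfl
  rcases hins : columnInsert v P with ⟨P', r, k⟩
  simp only [hins] at *
  have hanti := htab.columnLength_antitone
  refine ⟨⟨?_, ?_, ?_, ?_, ?_, ?_⟩, ?_, ?_⟩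
  · rw [hPs]; exact htab
  · rw [hPs]
    intro z hz
    rcases (hmem z).1 hz with rfl | hz
    · exact h2
    · exact h.mem_range z hz
  · intro i j hj
    rw [hPs, hlen] at hj
    rw [hQ]
    have hz := h.zeros i j (by simp only; omega)
    split_ifs at hj ⊢ with h3 h4 <;> simp_all
  · intro i j hj
    rw [hPs, hlen] at hj
    rw [hQ]
    split_ifs with h3
    · exact h1
    · refine h.range i j ?_
      simp only [Prod.mk.injEq] at h3
      simp only
      split_ifs at hj with h4
      · subst h4; omega
      · omega
  · intro i j₁ j₂ hlt hj
    rw [hPs, hlen] at hj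
    rw [hQ, hQ]
    simp only [Prod.mk.injEq]
    by_cases h4 : i = k
    · subst h4
      simp only [and_true, if_true] at hj ⊢
      rw [if_neg (by omega)]
      split_ifs with h5
      · exact (hmax i j₁).1
      · exact h.row_weak i j₁ j₂ hlt (by simp only; omega)
    · simp only [h4, and_false, if_false] at hj ⊢
      exact h.row_weak i j₁ j₂ hlt (by simpa using hj)
  · intro i₁ i₂ j hlt hj
    have hj1 : j < columnLength P' i₁ := lt_of_lt_of_le hj (by rw [hPs]; exact hanti hlt.le)
    rw [hPs] at hj
    have hj' := hj
    rw [hlen] at hj hj1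
    rw [hQ, hQ]
    simp only [Prod.mk.injEq]
    have hold := (h.columns.columnLength_antitone hlt.le)
    simp only at hold
    -- The new box is the top of its column in the second filling, so it cannot be the lower of the
    -- two boxes.
    have hneg : ¬ (j = r ∧ i₁ = k) := by
      rintro ⟨rfl, rfl⟩
      rw [if_neg (by omega)] at hj
      omega
    rw [if_neg hneg]
    · split_ifs with h5
      · obtain ⟨rfl, rfl⟩ := h5
        have := hmax i₁ j
        omega
      · refine h.col_strict _ _ j hlt ?_
        simp only
        split_ifs at hj with h6
        · subst h6; omega
        · omega
  · simp [hQ]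
  · intro i j
    rw [hQ]
    split_ifs with h5
    · simp only [Prod.mk.injEq] at h5
      simp only
      omega
    · have := hmax i j
      simp only
      omega

/-- The common result determines the last box, reverse insertion from it recovers the first tableau,
and the second filling was `0` in that box before the step. -/
lemma knuthStep_inj {N : ℕ} {s s' : List (List ℕ) × (ℕ → ℕ → ℕ)} (h : IsKnuthPair N s)
    (h' : IsKnuthPair N s') {p p' : ℕ × ℕ} (hs : IsKnuthPair N (knuthStep s p)) (hp : p.1 ≠ 0)
    (hb : IsLastBox (knuthStep s p).2 (columnInsert p.2 s.1).2 p.1)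
    (hb' : IsLastBox (knuthStep s' p').2 (columnInsert p'.2 s'.1).2 p'.1)
    (heq : knuthStep s p = knuthStep s' p') : s = s' ∧ p = p' := by
  rw [← heq] at hb'
  obtain ⟨hbox, hu⟩ := IsLastBox.unique hs hp hb hb'
  obtain ⟨hv, hP⟩ := columnInsert_inj h.columns h'.columns
    (Prod.ext (show (knuthStep s p).1 = (knuthStep s' p').1 by rw [heq]) hbox)
  refine ⟨Prod.ext hP ?_, Prod.ext hu hv⟩
  funext i j
  by_cases hij : (j, i) = (columnInsert p.2 s.1).2
  · have e1 := columnInsert_box p.2 s.1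
    have e2 := columnInsert_box p'.2 s'.1
    rw [← hbox] at e2
    rw [← hij] at e1 e2
    rw [h.zeros i j e1.ge, h'.zeros i j e2.ge]
  · have := congrFun (congrFun (congrArg Prod.snd heq) i) j
    rwa [knuthStep_snd, knuthStep_snd, if_neg hij, if_neg (hbox ▸ hij)] at this

/-- The number of boxes is the measure for the induction in `exists_knuthFold_eq`. -/
lemma length_flatten_columnInsert (x : ℕ) (P : List (List ℕ)) :
    (columnInsert x P).1.flatten.length = P.flatten.length + 1 := by
  induction P generalizing x with
  | nil => simp [columnInsert]
  | cons c cs ih =>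
    rcases hb : bumpColumn x c with ⟨c', _ | y⟩
    · rw [columnInsert_cons_none cs hb, (bumpColumn_none hb).1]
      simp only [List.flatten_cons, List.length_append, List.length_singleton]
      omega
    · rw [columnInsert_cons_some cs hb]
      simp only [List.flatten_cons, List.length_append, ih, bumpColumn_length hb]
      omega

lemma IsKnuthPair.exists_isLastBox {N : ℕ} {s : List (List ℕ) × (ℕ → ℕ → ℕ)}
    (h : IsKnuthPair N s) (hne : s.1 ≠ []) :
    ∃ b u, u ≠ 0 ∧ IsLastBox s.2 b u := by
  have hmem : (0, 0) ∈ (columnShape s.1 h.columns).cells := by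
    rw [YoungDiagram.mem_cells, mem_columnShape]
    rcases hs : s.1 with _ | ⟨c, cs⟩
    · exact absurd hs hne
    · have := h.columns
      rw [hs] at this
      simpa [List.length_pos_iff] using this.1
  -- `b₀` carries the largest entry; then `b` maximises the column of the second filling among the
  -- boxes with this entry.
  obtain ⟨b₀, hb₀, hmax₀⟩ := Finset.exists_max_image _ (fun b : ℕ × ℕ => s.2 b.2 b.1) ⟨_, hmem⟩
  obtain ⟨b, hb, hmax⟩ := Finset.exists_max_image
    ((columnShape s.1 h.columns).cells.filter fun b => s.2 b.2 b.1 = s.2 b₀.2 b₀.1)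
    (fun b : ℕ × ℕ => b.1) ⟨b₀, by simpa using hb₀⟩
  rw [Finset.mem_filter] at hb
  rw [YoungDiagram.mem_cells] at hb₀
  have hpos := (h.range b₀.2 b₀.1 (mem_columnShape.1 hb₀)).1
  refine ⟨b, s.2 b₀.2 b₀.1, by omega, hb.2, fun i j => ?_⟩
  by_cases hij : s.2 i j = 0
  · omega
  · have hc : (j, i) ∈ (columnShape s.1 h.columns).cells := by
      rw [YoungDiagram.mem_cells, mem_columnShape]
      exact h.lt_columnLength hij
    exact ⟨hmax₀ _ hc, fun he => hmax (j, i) (Finset.mem_filter.2 ⟨hc, he⟩)⟩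

lemma IsKnuthPair.exists_knuthStep_eq {N : ℕ} {s' : List (List ℕ) × (ℕ → ℕ → ℕ)}
    (h : IsKnuthPair N s') {b : ℕ × ℕ} {u : ℕ} (hu : u ≠ 0) (hb : IsLastBox s'.2 b u) :
    ∃ s v, IsKnuthPair N s ∧ 1 ≤ v ∧ v ≤ N ∧ (columnInsert v s.1).2 = b ∧
      knuthStep s (u, v) = s' := by
  obtain ⟨P', Q'⟩ := s'
  obtain ⟨r, k⟩ := b
  obtain ⟨hval, hmax⟩ := hb
  simp only at hval hmax
  have hin : r < columnLength P' k := h.lt_columnLength (i := k) (j := r) (by simp only; omega)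
  -- The box is a corner: a right neighbour in the second filling would be another `u` further
  -- right, and an entry above would exceed `u`.
  have h1 : columnLength P' k = r + 1 := by
    by_contra hne
    have h3 := h.row_weak k r (r + 1) (by omega) (by simp only; omega)
    have h4 := hmax k (r + 1)
    simp only at h3
    omega
  have h2 : columnLength P' (k + 1) ≤ r := by
    by_contra hlt
    have h3 := h.col_strict k (k + 1) r (by omega) (by simp only; omega)
    have h4 := hmax (k + 1) r
    simp only at h3
    omega
  obtain ⟨v, P, hP, hins⟩ := exists_columnInsert_eq h.columns h1 h2
  have hlen := columnLength_columnInsert v P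
  have hmem := mem_columnInsert v P
  simp only [hins] at hlen hmem
  have hle : ∀ i, columnLength P i ≤ columnLength P' i := fun i => by rw [hlen]; omega
  have hk : columnLength P k = r := by
    have := hlen k
    simp at this
    omega
  refine ⟨(P, fun i j => if (j, i) = (r, k) then 0 else Q' i j), v, ⟨hP, ?_, ?_, ?_, ?_, ?_⟩,
    (h.mem_range v ((hmem v).2 (Or.inl rfl))).1, (h.mem_range v ((hmem v).2 (Or.inl rfl))).2,
    by rw [hins], ?_⟩
  · exact fun z hz => h.mem_range z ((hmem z).2 (Or.inr hz))
  · intro i j hj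
    simp only at hj ⊢
    split_ifs with h3
    · rfl
    · refine h.zeros i j ?_
      simp only [Prod.mk.injEq] at h3
      simp only [hlen]
      split_ifs with h4
      · subst h4; omega
      · omega
  all_goals simp only [Prod.mk.injEq]
  · intro i j hj
    rw [if_neg (by rintro ⟨rfl, rfl⟩; omega)]
    exact h.range i j (hj.trans_le (hle i))
  · intro i j₁ j₂ hlt hj
    rw [if_neg (by rintro ⟨rfl, rfl⟩; omega), if_neg (by rintro ⟨rfl, rfl⟩; omega)]
    exact h.row_weak i j₁ j₂ hlt (hj.trans_le (hle i))
  · intro i₁ i₂ j hlt hj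
    have := hP.columnLength_antitone hlt.le
    rw [if_neg (by rintro ⟨rfl, rfl⟩; omega), if_neg (by rintro ⟨rfl, rfl⟩; omega)]
    exact h.col_strict i₁ i₂ j hlt (hj.trans_le (hle i₂))
  · refine Prod.ext (by simp [knuthStep, hins]) ?_
    funext i j
    rw [knuthStep_snd]
    simp only [hins, Prod.mk.injEq]
    split_ifs with h3
    · rw [h3.1, h3.2, hval]
    · rfl

/-! ### Knuth's correspondence for two-rowed arrays -/

/-- The strict lexicographic order on pairs. -/
def LexLT (p q : ℕ × ℕ) : Prop := p.1 < q.1 ∨ (p.1 = q.1 ∧ p.2 < q.2)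

lemma LexLT.trans {p q r : ℕ × ℕ} (h : LexLT p q) (h' : LexLT q r) : LexLT p r := by
  unfold LexLT at *
  omega

/-- A strictly lexicographically increasing two-rowed array with entries in `{1, …, N}`. -/
def IsBiword (N : ℕ) (w : List (ℕ × ℕ)) : Prop :=
  w.Pairwise LexLT ∧ ∀ p ∈ w, (1 ≤ p.1 ∧ p.1 ≤ N) ∧ (1 ≤ p.2 ∧ p.2 ≤ N)

/-- Knuth's construction applied to a two-rowed array. -/
def knuthFold (w : List (ℕ × ℕ)) : List (List ℕ) × (ℕ → ℕ → ℕ) :=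
  w.foldl knuthStep ([], fun _ _ => 0)

lemma knuthFold_append (w : List (ℕ × ℕ)) (p : ℕ × ℕ) :
    knuthFold (w ++ [p]) = knuthStep (knuthFold w) p := by
  simp [knuthFold]

lemma isColumnTableau_knuthFold (w : List (ℕ × ℕ)) : IsColumnTableau (knuthFold w).1 := by
  induction w using List.reverseRecOn with
  | nil => trivial
  | append_singleton w p ih =>
    rw [knuthFold_append]
    exact ih.columnInsert p.2

lemma isBiword_append {N : ℕ} {w : List (ℕ × ℕ)} {p : ℕ × ℕ} :
    IsBiword N (w ++ [p]) ↔ IsBiword N w ∧ (∀ q ∈ w, LexLT q p) ∧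
      (1 ≤ p.1 ∧ p.1 ≤ N) ∧ (1 ≤ p.2 ∧ p.2 ≤ N) := by
  simp only [IsBiword, List.pairwise_append, List.mem_append, List.mem_singleton, or_imp,
    forall_and, forall_eq, List.pairwise_singleton]
  tauto

/-- Knowing the last box is part of the induction: with `columnInsert_row_lt` and the lexicographic
order, it provides the hypothesis `hmax` of the next step. -/
lemma isKnuthPair_knuthFold {N : ℕ} {w : List (ℕ × ℕ)} (hw : IsBiword N w) :
    IsKnuthPair N (knuthFold w) ∧ ∀ w₀ p, w = w₀ ++ [p] →
      IsLastBox (knuthFold w).2 (columnInsert p.2 (knuthFold w₀).1).2 p.1 := by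
  induction w using List.reverseRecOn with
  | nil => exact ⟨isKnuthPair_nil N, fun w₀ p h => by simp at h⟩
  | append_singleton w p ih =>
    rw [isBiword_append] at hw
    obtain ⟨ih1, ih2⟩ := ih hw.1
    have := isKnuthPair_knuthStep ih1 hw.2.2.1 hw.2.2.2 ?_
    · rw [← knuthFold_append] at this
      refine ⟨this.1, fun w₀ q h => ?_⟩
      obtain ⟨rfl, h⟩ := List.append_inj' h rfl
      obtain rfl : p = q := by simpa using h
      exact this.2
    · rcases List.eq_nil_or_concat w with rfl | ⟨w₀, q, rfl⟩
      · intro i j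
        have : (knuthFold []).2 i j = 0 := rfl
        omega
      · rw [List.concat_eq_append] at *
        have hlast := ih2 w₀ q rfl
        have hq := hw.2.1 q (by simp)
        intro i j
        have h3 := hlast.2 i j
        unfold LexLT at hq
        refine ⟨by omega, fun he => (h3.2 (by omega)).trans_lt ?_⟩
        rw [knuthFold_append]
        exact columnInsert_row_lt (isColumnTableau_knuthFold w₀) (by omega)

lemma knuthFold_append_ne_nil {N : ℕ} {w : List (ℕ × ℕ)} {p : ℕ × ℕ}
    (hw : IsBiword N (w ++ [p])) : knuthFold (w ++ [p]) ≠ knuthFold [] := by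
  intro h
  have h1 := ((isKnuthPair_knuthFold hw).2 w p rfl).1
  rw [h] at h1
  have h2 := (isBiword_append.1 hw).2.2.1
  have h3 : (knuthFold []).2 (columnInsert p.2 (knuthFold w).1).2.2
    (columnInsert p.2 (knuthFold w).1).2.1 = 0 := rfl
  omega

lemma knuthFold_inj {N : ℕ} {w w' : List (ℕ × ℕ)} (hw : IsBiword N w) (hw' : IsBiword N w')
    (h : knuthFold w = knuthFold w') : w = w' := by
  induction w using List.reverseRecOn generalizing w' with
  | nil =>
    rcases List.eq_nil_or_concat w' with rfl | ⟨w₀, q, rfl⟩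
    · rfl
    · rw [List.concat_eq_append] at *
      exact absurd h.symm (knuthFold_append_ne_nil hw')
  | append_singleton w p ih =>
    rcases List.eq_nil_or_concat w' with rfl | ⟨w₀, q, rfl⟩
    · exact absurd h (knuthFold_append_ne_nil hw)
    · rw [List.concat_eq_append] at *
      have k := isKnuthPair_knuthFold hw
      have k' := isKnuthPair_knuthFold hw'
      have hb := k.2 w p rfl
      have hb' := k'.2 w₀ q rfl
      have hs := k.1
      rw [isBiword_append] at hw hw'
      rw [knuthFold_append] at hb hb' hs
      rw [knuthFold_append, knuthFold_append] at h
      obtain ⟨h1, rfl⟩ := knuthStep_inj (isKnuthPair_knuthFold hw.1).1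
        (isKnuthPair_knuthFold hw'.1).1 hs (by omega) hb hb' h
      rw [ih hw.1 hw'.1 h1]

lemma exists_knuthFold_eq {N : ℕ} {s : List (List ℕ) × (ℕ → ℕ → ℕ)} (hs : IsKnuthPair N s) :
    ∃ w, IsBiword N w ∧ knuthFold w = s := by
  induction hn : s.1.flatten.length generalizing s with
  | zero =>
    obtain ⟨P, Q⟩ := s
    obtain rfl : P = [] := by
      rcases P with _ | ⟨c, cs⟩
      · rfl
      · simp at hn
        exact absurd hn.1 hs.columns.1
    refine ⟨[], by simp [IsBiword], Prod.ext rfl ?_⟩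
    funext i j
    exact (hs.zeros i j (by simp)).symm
  | succ n ih =>
    obtain ⟨b, u, hu, hb⟩ := hs.exists_isLastBox (by intro h; simp [h] at hn)
    obtain ⟨t, v, ht, hv1, hv2, hbox, hstep⟩ := hs.exists_knuthStep_eq hu hb
    have hlen := length_flatten_columnInsert v t.1
    rw [show (columnInsert v t.1).1 = s.1 by rw [← hstep]; rfl] at hlen
    obtain ⟨w, hw, rfl⟩ := ih ht (by omega)
    refine ⟨w ++ [(u, v)], ?_, by rw [knuthFold_append, hstep]⟩
    have hur : 1 ≤ u ∧ u ≤ N := by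
      rw [← hb.1]
      refine hs.range _ _ (hs.lt_columnLength ?_)
      rw [hb.1]
      exact hu
    rw [isBiword_append]
    refine ⟨hw, ?_, hur, hv1, hv2⟩
    rcases List.eq_nil_or_concat w with rfl | ⟨w₀, q, rfl⟩
    · simp
    rw [List.concat_eq_append] at *
    have hlast := (isKnuthPair_knuthFold hw).2 w₀ q rfl
    rw [isBiword_append] at hw
    -- Maximality of `u` gives `q.1 ≤ u`. If these are equal and `v ≤ q.2`, then
    -- `columnInsert_row_le` and the rightmost position of `b` put both occurrences of `u` in one
    -- column of the second filling, against strictness.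
    have hq : LexLT q (u, v) := by
      set b₀ := (columnInsert q.2 (knuthFold w₀).1).2 with hb₀
      have hne : b₀ ≠ b := by
        intro he
        have e := columnInsert_box v (knuthFold (w₀ ++ [q])).1
        rw [hbox, ← he] at e
        have := ht.zeros b₀.2 b₀.1 e.ge
        rw [hlast.1] at this
        omega
      have hval : s.2 b₀.2 b₀.1 = q.1 := by
        rw [← hstep, knuthStep_snd, hbox, if_neg hne, hlast.1]
      have h5 := hb.2 b₀.2 b₀.1
      rw [hval] at h5
      rcases h5.1.lt_or_eq with hlt | heq
      · exact Or.inl hlt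
      · refine Or.inr ⟨heq, ?_⟩
        by_contra hle
        have h6 : b.1 ≤ b₀.1 := by
          have := columnInsert_row_le (isColumnTableau_knuthFold w₀) (not_lt.1 hle)
          simp only at this
          rw [knuthFold_append] at hbox
          rw [← hbox]
          exact this
        have h7 : b₀.1 = b.1 := le_antisymm (h5.2 heq) h6
        refine hne (Prod.ext h7 (hs.col_inj (j := b₀.1) ?_ ?_))
        · rw [hval]; omega
        · rw [hval, heq, h7, hb.1]
    intro p hp
    simp only [List.mem_append, List.mem_singleton] at hp
    rcases hp with hp | rfl
    · exact (hw.2.1 p hp).trans hq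
    · exact hq

/-! ### Two-rowed arrays of matrices -/

lemma pairwise_arrayOfMatrix (N : ℕ) (M : Matrix (Fin N) (Fin N) (Fin 2)) :
    (arrayOfMatrix N M).Pairwise LexLT := by
  have aux : ∀ l : List (Fin N), l.Pairwise (· < ·) →
      (l ×ˢ List.finRange N).Pairwise fun p q => p.1 < q.1 ∨ (p.1 = q.1 ∧ p.2 < q.2) := by
    intro l hl
    induction l with
    | nil => simp
    | cons a l ih =>
      rw [List.pairwise_cons] at hl
      rw [List.product_cons, List.pairwise_append]
      refine ⟨?_, ih hl.2, ?_⟩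
      · rw [List.pairwise_map]
        exact (List.pairwise_lt_finRange N).imp fun h => Or.inr ⟨rfl, h⟩
      · intro p hp q hq
        rw [List.mem_map] at hp
        obtain ⟨c, -, rfl⟩ := hp
        exact Or.inl (hl.1 _ (List.mem_product.1 hq).1)
  rw [arrayOfMatrix, List.pairwise_map]
  refine ((aux _ (List.pairwise_lt_finRange N)).filter _).imp fun {p q} h => ?_
  simp only [LexLT, Fin.lt_def, Fin.ext_iff] at h ⊢
  omega

lemma mem_arrayOfMatrix {N : ℕ} {M : Matrix (Fin N) (Fin N) (Fin 2)} {p : ℕ × ℕ} :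
    p ∈ arrayOfMatrix N M ↔ ∃ i j : Fin N, M i j = 1 ∧ ((i : ℕ) + 1, (j : ℕ) + 1) = p := by
  simp [arrayOfMatrix]

lemma isBiword_arrayOfMatrix (N : ℕ) (M : Matrix (Fin N) (Fin N) (Fin 2)) :
    IsBiword N (arrayOfMatrix N M) := by
  refine ⟨pairwise_arrayOfMatrix N M, fun p hp => ?_⟩
  obtain ⟨i, j, -, rfl⟩ := mem_arrayOfMatrix.1 hp
  simp only
  omega

lemma mem_arrayOfMatrix_succ {N : ℕ} {M : Matrix (Fin N) (Fin N) (Fin 2)} {i j : Fin N} :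
    ((i : ℕ) + 1, (j : ℕ) + 1) ∈ arrayOfMatrix N M ↔ M i j = 1 := by
  rw [mem_arrayOfMatrix]
  constructor
  · rintro ⟨i', j', h, he⟩
    simp only [Prod.mk.injEq, add_left_inj, Fin.val_inj] at he
    rwa [← he.1, ← he.2]
  · exact fun h => ⟨i, j, h, rfl⟩

lemma arrayOfMatrix_injective (N : ℕ) : Function.Injective (arrayOfMatrix N) := by
  intro M M' h
  ext i j
  have : M i j = 1 ↔ M' i j = 1 := by
    rw [← mem_arrayOfMatrix_succ, h, mem_arrayOfMatrix_succ]
  have h1 := (M i j).isLt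
  have h2 := (M' i j).isLt
  simp only [Fin.ext_iff, Fin.val_one] at this
  omega

/-- A list sorted for `LexLT` is determined by its members, so the indicator matrix of `w` works. -/
lemma exists_arrayOfMatrix_eq {N : ℕ} {w : List (ℕ × ℕ)} (hw : IsBiword N w) :
    ∃ M, arrayOfMatrix N M = w := by
  refine ⟨Matrix.of fun i j => if ((i : ℕ) + 1, (j : ℕ) + 1) ∈ w then 1 else 0, ?_⟩
  have hirr : ∀ {l : List (ℕ × ℕ)}, l.Pairwise LexLT → l.Nodup := fun h =>
    h.imp fun {p q} hpq he => by
      subst he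
      unfold LexLT at hpq
      omega
  refine List.Perm.eq_of_pairwise (le := LexLT) ?_ (pairwise_arrayOfMatrix N _) hw.1 ?_
  · intro p q _ _ h1 h2
    unfold LexLT at h1 h2
    omega
  · rw [List.perm_ext_iff_of_nodup (hirr (pairwise_arrayOfMatrix N _)) (hirr hw.1)]
    intro p
    rw [mem_arrayOfMatrix]
    constructor
    · rintro ⟨i, j, h, rfl⟩
      by_contra hn
      simp [hn] at h
    · intro hp
      obtain ⟨h1, h2⟩ := hw.2 p hp
      refine ⟨⟨p.1 - 1, by omega⟩, ⟨p.2 - 1, by omega⟩, ?_, ?_⟩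
      · simp [Nat.sub_add_cancel h1.1, Nat.sub_add_cancel h2.1, hp]
      · ext <;> simp <;> omega

/-! ### Knuth's bijection -/

lemma knuthMap_eq (N : ℕ) (M : Matrix (Fin N) (Fin N) (Fin 2)) :
    knuthMap N M = (fillingOfColumns (knuthFold (arrayOfMatrix N M)).1,
      (knuthFold (arrayOfMatrix N M)).2) := rfl

lemma isKnuthPair_iff {N : ℕ} {P : List (List ℕ)} {Q : ℕ → ℕ → ℕ} (hP : IsColumnTableau P)
    (hN : ∀ z ∈ P.flatten, 1 ≤ z ∧ z ≤ N) :
    IsKnuthPair N (P, Q) ↔ IsYoungTableau N (columnShape P hP).transpose Q := by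
  rw [isYoungTableau_iff]
  simp only [YoungDiagram.mem_transpose, Prod.swap_prod_mk, mem_columnShape, not_lt]
  exact ⟨fun h => ⟨h.row_weak, h.col_strict, h.zeros, h.range⟩,
    fun ⟨h1, h2, h3, h4⟩ => ⟨hP, hN, h3, h4, h1, h2⟩⟩

theorem bijOn_knuthMap (N : ℕ) :
    Set.BijOn (knuthMap N) Set.univ (conjugatePairs N) := by
  refine ⟨fun M _ => ?_, fun M _ M' _ h => ?_, ?_⟩
  · have h := (isKnuthPair_knuthFold (isBiword_arrayOfMatrix N M)).1
    exact ⟨columnShape _ h.columns, isYoungTableau_fillingOfColumns h.columns h.mem_range,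
      (isKnuthPair_iff h.columns h.mem_range).1 h⟩
  · have hk := (isKnuthPair_knuthFold (isBiword_arrayOfMatrix N M)).1
    have hk' := (isKnuthPair_knuthFold (isBiword_arrayOfMatrix N M')).1
    rw [knuthMap_eq, knuthMap_eq, Prod.mk.injEq] at h
    refine arrayOfMatrix_injective N (knuthFold_inj (isBiword_arrayOfMatrix N M)
      (isBiword_arrayOfMatrix N M') (Prod.ext ?_ h.2))
    exact fillingOfColumns_inj hk.columns hk'.columns (fun z hz => (hk.mem_range z hz).1)
      (fun z hz => (hk'.mem_range z hz).1) h.1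
  · rintro ⟨A, Q⟩ ⟨μ, hA, hQ⟩
    obtain ⟨P, hP, hPA, hN, hlen⟩ := exists_columns_of_isYoungTableau hA
    have hμ : columnShape P hP = μ := by
      refine YoungDiagram.ext (Finset.ext fun ⟨i, j⟩ => ?_)
      rw [YoungDiagram.mem_cells, YoungDiagram.mem_cells, mem_columnShape, hlen,
        YoungDiagram.mem_iff_lt_colLen]
    subst hμ
    obtain ⟨w, hw, hwe⟩ := exists_knuthFold_eq ((isKnuthPair_iff hP hN).2 hQ)
    obtain ⟨M, rfl⟩ := exists_arrayOfMatrix_eq hw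
    refine ⟨M, trivial, ?_⟩
    rw [knuthMap_eq, hwe]
    exact Prod.ext hPA rfl

/-! ### Increasing enumerations of finite sets -/

/-- Both sides are `0` beyond the cardinality. Through `Nat.nth`, columns can be compared by means
of `Nat.count`. -/
lemma sort_getD_eq_nth (s : Finset ℕ) (i : ℕ) :
    (s.sort (· ≤ ·)).getD i 0 = Nat.nth (· ∈ s) i := by
  have hf : (Set.ofPred (· ∈ s)).Finite := s.finite_toSet
  rw [Nat.nth_eq_getD_sort hf]
  congr 2
  ext x
  simp

lemma lt_card_of_lt_card {s : Finset ℕ} {i : ℕ} (hi : i < s.card)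
    (hf : (Set.ofPred (· ∈ s)).Finite) : i < hf.toFinset.card := by
  rwa [show hf.toFinset = s by ext x; simp]

lemma nth_mem_finset {s : Finset ℕ} {i : ℕ} (hi : i < s.card) : Nat.nth (· ∈ s) i ∈ s :=
  Nat.nth_mem i (lt_card_of_lt_card hi)

lemma nth_finset_lt {s : Finset ℕ} {i j : ℕ} (hij : i < j) (hj : j < s.card) :
    Nat.nth (· ∈ s) i < Nat.nth (· ∈ s) j :=
  Nat.nth_lt_nth' hij (lt_card_of_lt_card hj)

lemma nth_finset_eq_zero {s : Finset ℕ} {i : ℕ} (hi : s.card ≤ i) : Nat.nth (· ∈ s) i = 0 := by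
  rw [← sort_getD_eq_nth]
  exact List.getD_eq_default _ _ (by simpa using hi)

lemma exists_nth_finset_eq {s : Finset ℕ} {x : ℕ} (hx : x ∈ s) :
    ∃ i < s.card, Nat.nth (· ∈ s) i = x := by
  have hf : (Set.ofPred (· ∈ s)).Finite := s.finite_toSet
  obtain ⟨i, hi, h⟩ := Nat.exists_lt_card_finite_nth_eq hf hx
  rw [show hf.toFinset = s by ext x; simp] at hi
  exact ⟨i, hi, h⟩

/-- With the converse that follows, this turns the entrywise comparison of columns into one of
counting functions, whose behaviour under complements is plain from `count_add_count_sdiff`. -/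
lemma nth_finset_le_of_count_le {s t : Finset ℕ}
    (h : ∀ x, Nat.count (· ∈ t) x ≤ Nat.count (· ∈ s) x) {i : ℕ} (hi : i < t.card) :
    Nat.nth (· ∈ s) i ≤ Nat.nth (· ∈ t) i := by
  have h1 := Nat.count_nth_succ (p := (· ∈ t)) (lt_card_of_lt_card hi)
  have h2 := h (Nat.nth (· ∈ t) i + 1)
  exact Nat.le_of_lt_add_one (Nat.nth_lt_of_lt_count (by omega))

lemma count_le_of_nth_finset_le {s t : Finset ℕ} (hst : t.card ≤ s.card)
    (h : ∀ i < t.card, Nat.nth (· ∈ s) i ≤ Nat.nth (· ∈ t) i) (x : ℕ) :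
    Nat.count (· ∈ t) x ≤ Nat.count (· ∈ s) x := by
  rcases hk : Nat.count (· ∈ t) x with _ | k
  · exact Nat.zero_le _
  have hlt : Nat.nth (· ∈ t) k < x := Nat.nth_lt_of_lt_count (by omega)
  have hf : (Set.ofPred (· ∈ t)).Finite := t.finite_toSet
  have hkt : k < t.card := by
    have := Nat.count_le_card hf x
    rw [show hf.toFinset = t by ext x; simp] at this
    omega
  have h1 := Nat.count_nth_succ (p := (· ∈ s)) (lt_card_of_lt_card (hkt.trans_le hst))
  have h2 := h k hkt
  have h3 := Nat.count_monotone (· ∈ s) (show Nat.nth (· ∈ s) k + 1 ≤ x by omega)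
  omega

lemma count_add_count_sdiff {s u : Finset ℕ} (h : s ⊆ u) (x : ℕ) :
    Nat.count (· ∈ s) x + Nat.count (· ∈ u \ s) x = Nat.count (· ∈ u) x := by
  induction x with
  | zero => simp
  | succ x ih =>
    simp only [Nat.count_succ, Finset.mem_sdiff] at ih ⊢
    have := @h x
    by_cases h1 : x ∈ s <;> by_cases h2 : x ∈ u <;> simp_all <;> omega

lemma nth_image_range {f : ℕ → ℕ} {n : ℕ} (hf : ∀ i j, i < j → j < n → f i < f j) {i : ℕ}
    (hi : i < n) : Nat.nth (· ∈ (Finset.range n).image f) i = f i := by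
  have hc : Nat.count (· ∈ (Finset.range n).image f) (f i) = i := by
    rw [Nat.count_eq_card_filter_range]
    have : (Finset.range (f i)).filter (· ∈ (Finset.range n).image f) =
        (Finset.range i).image f := by
      ext x
      simp only [Finset.mem_filter, Finset.mem_range, Finset.mem_image]
      constructor
      · rintro ⟨hx, j, hj, rfl⟩
        refine ⟨j, ?_, rfl⟩
        by_contra hij
        rcases (not_lt.1 hij).lt_or_eq with h | rfl
        · have := hf i j h hj
          omega
        · omega
      · rintro ⟨j, hj, rfl⟩
        exact ⟨hf j i hj hi, j, hj.trans hi, rfl⟩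
    rw [this, Finset.card_image_of_injOn, Finset.card_range]
    intro a ha b hb hab
    simp only [Finset.coe_range, Set.mem_Iio] at ha hb
    rcases lt_trichotomy a b with h | h | h
    · have := hf a b h (hb.trans hi); omega
    · exact h
    · have := hf b a h (ha.trans hi); omega
  have := Nat.nth_count (p := (· ∈ (Finset.range n).image f)) (n := f i)
    (Finset.mem_image.2 ⟨i, Finset.mem_range.2 hi, rfl⟩)
  rwa [hc] at this

/-! ### Column complements -/

/-- The set of the entries in `{1, …, N}` of the `j`-th column of `T`. -/
def columnSet (N : ℕ) (T : ℕ → ℕ → ℕ) (j : ℕ) : Finset ℕ :=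
  Finset.Icc 1 N ∩ (Finset.range N).image fun k => T k j

lemma columnComplement_eq_nth {N : ℕ} (T : ℕ → ℕ → ℕ) (i : ℕ) {j : ℕ} (hj : j < N) :
    columnComplement N T i j =
      Nat.nth (· ∈ Finset.Icc 1 N \ columnSet N T (N - 1 - j)) i := by
  rw [columnComplement, if_pos hj, sort_getD_eq_nth, columnSet, Finset.sdiff_inter_self_left]

lemma mem_complementDiagram {N : ℕ} {μ : YoungDiagram} {i j : ℕ} :
    (i, j) ∈ complementDiagram N μ ↔ (i < N ∧ j < N) ∧ (N - 1 - j, N - 1 - i) ∉ μ := by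
  rw [← YoungDiagram.mem_cells]
  simp [complementDiagram]

lemma colLen_le {N : ℕ} {μ : YoungDiagram} (hμ : FitsInSquare N μ) (j : ℕ) : μ.colLen j ≤ N := by
  by_contra h
  have := hμ N j (YoungDiagram.mem_iff_lt_colLen.2 (not_le.1 h))
  omega

lemma columnSet_eq {N : ℕ} {μ : YoungDiagram} {T : ℕ → ℕ → ℕ} (h : IsYoungTableau N μ T)
    (hμ : FitsInSquare N μ) (j : ℕ) :
    columnSet N T j = (Finset.range (μ.colLen j)).image fun i => T i j := by
  obtain ⟨-, -, hzero, hrange⟩ := isYoungTableau_iff.1 h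
  ext x
  simp only [columnSet, Finset.mem_inter, Finset.mem_Icc, Finset.mem_image, Finset.mem_range]
  constructor
  · rintro ⟨hx, i, -, rfl⟩
    refine ⟨i, ?_, rfl⟩
    by_contra hi
    have := hzero i j (by rwa [YoungDiagram.mem_iff_lt_colLen])
    omega
  · rintro ⟨i, hi, rfl⟩
    exact ⟨hrange i j (YoungDiagram.mem_iff_lt_colLen.2 hi), i, hi.trans_le (colLen_le hμ j), rfl⟩

lemma card_columnSet {N : ℕ} {μ : YoungDiagram} {T : ℕ → ℕ → ℕ} (h : IsYoungTableau N μ T)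
    (hμ : FitsInSquare N μ) (j : ℕ) : (columnSet N T j).card = μ.colLen j := by
  obtain ⟨-, hcol, -, -⟩ := isYoungTableau_iff.1 h
  rw [columnSet_eq h hμ, Finset.card_image_of_injOn, Finset.card_range]
  intro a ha b hb hab
  simp only [Finset.coe_range, Set.mem_Iio, ← YoungDiagram.mem_iff_lt_colLen] at ha hb
  rcases lt_trichotomy a b with hlt | heq | hlt
  · have := hcol a b j hlt hb; simp only at hab; omega
  · exact heq
  · have := hcol b a j hlt ha; simp only at hab; omega

lemma nth_columnSet {N : ℕ} {μ : YoungDiagram} {T : ℕ → ℕ → ℕ} (h : IsYoungTableau N μ T)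
    (hμ : FitsInSquare N μ) (i j : ℕ) : Nat.nth (· ∈ columnSet N T j) i = T i j := by
  rcases lt_or_ge i (μ.colLen j) with hi | hi
  · rw [columnSet_eq h hμ]
    exact nth_image_range (f := fun i => T i j) (fun a b hab hb =>
      (isYoungTableau_iff.1 h).2.1 a b j hab (YoungDiagram.mem_iff_lt_colLen.2 hb)) hi
  · rw [nth_finset_eq_zero (by rwa [card_columnSet h hμ]),
      (isYoungTableau_iff.1 h).2.2.1 i j (by rw [YoungDiagram.mem_iff_lt_colLen]; omega)]

lemma columnSet_subset (N : ℕ) (T : ℕ → ℕ → ℕ) (j : ℕ) : columnSet N T j ⊆ Finset.Icc 1 N :=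
  Finset.inter_subset_left

lemma card_sdiff_columnSet {N : ℕ} {μ : YoungDiagram} {T : ℕ → ℕ → ℕ}
    (h : IsYoungTableau N μ T) (hμ : FitsInSquare N μ) (j : ℕ) :
    (Finset.Icc 1 N \ columnSet N T j).card = N - μ.colLen j := by
  rw [Finset.card_sdiff_of_subset (columnSet_subset N T j), card_columnSet h hμ]
  simp

lemma mem_complementDiagram_transpose {N : ℕ} {μ : YoungDiagram} {i j : ℕ} :
    (i, j) ∈ complementDiagram N μ.transpose ↔ j < N ∧ i < N - μ.colLen (N - 1 - j) := by
  rw [mem_complementDiagram, YoungDiagram.mem_transpose, Prod.swap_prod_mk,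
    YoungDiagram.mem_iff_lt_colLen]
  omega

/-- The column complement of a Young tableau is a Young tableau. -/
lemma isYoungTableau_columnComplement {N : ℕ} {μ : YoungDiagram} {T : ℕ → ℕ → ℕ}
    (h : IsYoungTableau N μ T) (hμ : FitsInSquare N μ) :
    IsYoungTableau N (complementDiagram N μ.transpose) (columnComplement N T) := by
  rw [isYoungTableau_iff]
  simp only [mem_complementDiagram_transpose]
  refine ⟨fun i j₁ j₂ hlt ⟨hj, hi⟩ => ?_, fun i₁ i₂ j hlt ⟨hj, hi⟩ => ?_, fun i j hij => ?_,
    fun i j ⟨hj, hi⟩ => ?_⟩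
  · rw [columnComplement_eq_nth T i hj, columnComplement_eq_nth T i (hlt.trans hj)]
    -- Column `N - 1 - j₂` of `T` is to the left of column `N - 1 - j₁`, hence has the larger
    -- counting function; its complement has the smaller one.
    refine nth_finset_le_of_count_le (fun x => ?_) (by rwa [card_sdiff_columnSet h hμ])
    have h1 := count_add_count_sdiff (columnSet_subset N T (N - 1 - j₁)) x
    have h2 := count_add_count_sdiff (columnSet_subset N T (N - 1 - j₂)) x
    have h3 := count_le_of_nth_finset_le (s := columnSet N T (N - 1 - j₂))
      (t := columnSet N T (N - 1 - j₁)) ?_ ?_ x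
    · omega
    · rw [card_columnSet h hμ, card_columnSet h hμ]
      exact μ.colLen_anti _ _ (by omega)
    · intro k hk
      rw [card_columnSet h hμ] at hk
      rw [nth_columnSet h hμ, nth_columnSet h hμ]
      exact (isYoungTableau_iff.1 h).1 _ _ _ (by omega) (YoungDiagram.mem_iff_lt_colLen.2 hk)
  · rw [columnComplement_eq_nth T _ hj, columnComplement_eq_nth T _ hj]
    exact nth_finset_lt hlt (by rwa [card_sdiff_columnSet h hμ])
  · by_cases hj : j < N
    · rw [columnComplement_eq_nth T _ hj]
      refine nth_finset_eq_zero ?_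
      rw [card_sdiff_columnSet h hμ]
      omega
    · rw [columnComplement, if_neg hj]
  · rw [columnComplement_eq_nth T _ hj]
    have := nth_mem_finset (s := Finset.Icc 1 N \ columnSet N T (N - 1 - j)) (i := i)
      (by rwa [card_sdiff_columnSet h hμ])
    exact Finset.mem_Icc.1 (Finset.mem_sdiff.1 this).1

lemma fitsInSquare_complementDiagram (N : ℕ) (μ : YoungDiagram) :
    FitsInSquare N (complementDiagram N μ) :=
  fun _ _ h => (mem_complementDiagram.1 h).1

lemma columnSet_columnComplement {N : ℕ} (T : ℕ → ℕ → ℕ) {j : ℕ} (hj : j < N) :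
    columnSet N (columnComplement N T) j = Finset.Icc 1 N \ columnSet N T (N - 1 - j) := by
  ext x
  rw [columnSet]
  simp only [Finset.mem_inter, Finset.mem_image, Finset.mem_range, columnComplement_eq_nth T _ hj]
  set s := Finset.Icc 1 N \ columnSet N T (N - 1 - j) with hs
  have hsub : s ⊆ Finset.Icc 1 N := Finset.sdiff_subset
  constructor
  · rintro ⟨hx, k, -, rfl⟩
    by_cases hk : k < s.card
    · exact nth_mem_finset hk
    · rw [nth_finset_eq_zero (not_lt.1 hk)] at hx
      simp at hx
  · intro hx
    obtain ⟨k, hk, he⟩ := exists_nth_finset_eq hx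
    have := Finset.card_le_card hsub
    simp only [Nat.card_Icc] at this
    exact ⟨hsub hx, k, by omega, he⟩

lemma columnComplement_columnComplement {N : ℕ} {μ : YoungDiagram} {T : ℕ → ℕ → ℕ}
    (h : IsYoungTableau N μ T) (hμ : FitsInSquare N μ) :
    columnComplement N (columnComplement N T) = T := by
  funext i j
  by_cases hj : j < N
  · rw [columnComplement_eq_nth _ _ hj, columnSet_columnComplement _ (by omega),
      Finset.sdiff_sdiff_eq_self (columnSet_subset N T _), Nat.sub_sub_self (by omega),
      nth_columnSet h hμ]
  · rw [columnComplement, if_neg hj, (isYoungTableau_iff.1 h).2.2.1 i j]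
    exact fun hm => hj (hμ i j hm).2

/-- Columns are strict and start with at least `1`, so the entry in row `i` is at least `i + 1`.
Applied to two conjugate shapes, this bounds both sides of the diagram. -/
lemma IsYoungTableau.lt_of_mem {N : ℕ} {μ : YoungDiagram} {T : ℕ → ℕ → ℕ}
    (h : IsYoungTableau N μ T) {i j : ℕ} (hij : (i, j) ∈ μ) : i < N := by
  obtain ⟨-, hcol, -, hrange⟩ := isYoungTableau_iff.1 h
  have : ∀ i, (i, j) ∈ μ → i + 1 ≤ T i j := by
    intro i
    induction i with
    | zero => exact fun hm => (hrange 0 j hm).1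
    | succ i ih =>
      intro hm
      have h1 := ih (μ.up_left_mem (Nat.le_succ i) le_rfl hm)
      have h2 := hcol i (i + 1) j (Nat.lt_succ_self i) hm
      omega
  exact (this i hij).trans (hrange i j hij).2

lemma fitsInSquare_of_conjugate {N : ℕ} {μ : YoungDiagram} {A T : ℕ → ℕ → ℕ}
    (hA : IsYoungTableau N μ A) (hT : IsYoungTableau N μ.transpose T) : FitsInSquare N μ :=
  fun i j h => ⟨hA.lt_of_mem h,
    hT.lt_of_mem (YoungDiagram.mem_transpose.2 (show (j, i).swap ∈ μ from h))⟩

lemma FitsInSquare.transpose {N : ℕ} {μ : YoungDiagram} (h : FitsInSquare N μ) :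
    FitsInSquare N μ.transpose := fun i j hm =>
  (h j i (YoungDiagram.mem_transpose.1 hm)).symm

lemma youngDiagram_ext {μ ν : YoungDiagram} (h : ∀ i j, (i, j) ∈ μ ↔ (i, j) ∈ ν) : μ = ν :=
  YoungDiagram.ext (Finset.ext fun ⟨i, j⟩ => by
    rw [YoungDiagram.mem_cells, YoungDiagram.mem_cells, h])

lemma complementDiagram_complementDiagram {N : ℕ} {μ : YoungDiagram} (h : FitsInSquare N μ) :
    complementDiagram N (complementDiagram N μ) = μ := by
  refine youngDiagram_ext fun i j => ?_
  rw [mem_complementDiagram, mem_complementDiagram]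
  constructor
  · rintro ⟨⟨hi, hj⟩, hn⟩
    rw [Nat.sub_sub_self (by omega), Nat.sub_sub_self (by omega)] at hn
    by_contra hm
    exact hn ⟨by omega, hm⟩
  · intro hm
    have := h i j hm
    rw [Nat.sub_sub_self (by omega), Nat.sub_sub_self (by omega)]
    exact ⟨this, fun hn => hn.2 hm⟩

lemma complementDiagram_transpose (N : ℕ) (μ : YoungDiagram) :
    complementDiagram N μ.transpose = (complementDiagram N μ).transpose := by
  refine youngDiagram_ext fun i j => ?_
  rw [YoungDiagram.mem_transpose, mem_complementDiagram, Prod.swap_prod_mk, mem_complementDiagram,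
    YoungDiagram.mem_transpose, Prod.swap_prod_mk, and_comm (a := i < N)]

/-- On tableaux that fit in the square the column complement is an involution, so it provides its
own inverse. -/
theorem bijOn_columnComplement (N : ℕ) :
    Set.BijOn (fun p : (ℕ → ℕ → ℕ) × (ℕ → ℕ → ℕ) => (p.1, columnComplement N p.2))
      (conjugatePairs N) (complementaryPairs N) := by
  refine ⟨?_, ?_, ?_⟩
  · rintro ⟨A, T⟩ ⟨μ, hA, hT⟩
    have hμ := fitsInSquare_of_conjugate hA hT
    have := isYoungTableau_columnComplement hT hμ.transpose
    rw [YoungDiagram.transpose_transpose] at this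
    exact ⟨μ, hμ, hA, this⟩
  · rintro ⟨A, T⟩ ⟨μ, hA, hT⟩ ⟨A', T'⟩ ⟨μ', hA', hT'⟩ h
    simp only [Prod.mk.injEq] at h hT hT' hA hA'
    refine Prod.ext h.1 ?_
    have := congrArg (columnComplement N) h.2
    rwa [columnComplement_columnComplement hT (fitsInSquare_of_conjugate hA hT).transpose,
      columnComplement_columnComplement hT' (fitsInSquare_of_conjugate hA' hT').transpose] at this
  · rintro ⟨A, B⟩ ⟨μ, hμ, hA, hB⟩
    have hfit := fitsInSquare_complementDiagram N μ
    refine ⟨(A, columnComplement N B), ⟨μ, hA, ?_⟩,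
      Prod.ext rfl (columnComplement_columnComplement hB hfit)⟩
    have := isYoungTableau_columnComplement hB hfit
    rwa [complementDiagram_transpose, complementDiagram_complementDiagram hμ] at this

/-! ### Divided squares -/

lemma injOn_placeInSquare (N : ℕ) :
    Set.InjOn (fun p : (ℕ → ℕ → ℕ) × (ℕ → ℕ → ℕ) => placeInSquare N p.1 p.2)
      (complementaryPairs N) := by
  rintro ⟨A, B⟩ ⟨μ, hμ, hA, hB⟩ ⟨A', B'⟩ ⟨μ', hμ', hA', hB'⟩ h
  simp only at h hA hB hA' hB'
  have hsq : ∀ i j, i < N → j < N → A i j = A' i j ∧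
      (A i j = 0 → B (N - 1 - j) (N - 1 - i) = B' (N - 1 - j) (N - 1 - i)) := by
    intro i j hi hj
    have := congrFun (congrFun h ⟨i, hi⟩) ⟨j, hj⟩
    simp only [placeInSquare, Fin.val_rev] at this
    rw [show N - (i + 1) = N - 1 - i by omega, show N - (j + 1) = N - 1 - j by omega] at this
    split_ifs at this with h1 h2 h2
    · simp only [Letter.chi.injEq] at this
      exact ⟨by omega, fun _ => this⟩
    · simp only [Letter.delta.injEq] at this
      exact ⟨this, fun h3 => absurd h3 h1⟩
  have hAeq : A = A' := by
    funext i j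
    by_cases hij : i < N ∧ j < N
    · exact (hsq i j hij.1 hij.2).1
    · rw [(isYoungTableau_iff.1 hA).2.2.1 i j fun hm => hij (hμ i j hm),
        (isYoungTableau_iff.1 hA').2.2.1 i j fun hm => hij (hμ' i j hm)]
  subst hAeq
  refine Prod.ext rfl ?_
  funext i j
  have hB0 := (isYoungTableau_iff.1 hB).2.2.1 i j
  have hB0' := (isYoungTableau_iff.1 hB').2.2.1 i j
  rw [mem_complementDiagram] at hB0 hB0'
  -- The box `(i, j)` of `B` occupies the box `(N - 1 - j, N - 1 - i)` of the square; if `A` is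
  -- nonzero there, `B` and `B'` both vanish at `(i, j)`.
  by_cases hij : i < N ∧ j < N
  · by_cases h0 : A (N - 1 - j) (N - 1 - i) = 0
    · have := (hsq (N - 1 - j) (N - 1 - i) (by omega) (by omega)).2 h0
      rwa [Nat.sub_sub_self (by omega), Nat.sub_sub_self (by omega)] at this
    · simp only
      rw [hB0 fun hn => h0 ((isYoungTableau_iff.1 hA).2.2.1 _ _ hn.2),
        hB0' fun hn => h0 ((isYoungTableau_iff.1 hA').2.2.1 _ _ hn.2)]
  · simp only
    rw [hB0 fun hn => hij hn.1, hB0' fun hn => hij hn.1]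

lemma dividedSquares_eq_image (N : ℕ) :
    dividedSquares N = (fun p : (ℕ → ℕ → ℕ) × (ℕ → ℕ → ℕ) => placeInSquare N p.1 p.2) ''
      complementaryPairs N := by
  ext S
  constructor
  · rintro ⟨μ, A, B, h, rfl⟩
    exact ⟨(A, B), ⟨μ, h⟩, rfl⟩
  · rintro ⟨⟨A, B⟩, ⟨μ, h⟩, rfl⟩
    exact ⟨μ, A, B, h, rfl⟩

lemma bijOn_placeInSquare (N : ℕ) :
    Set.BijOn (fun p : (ℕ → ℕ → ℕ) × (ℕ → ℕ → ℕ) => placeInSquare N p.1 p.2)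
      (complementaryPairs N) (dividedSquares N) := by
  rw [dividedSquares_eq_image]
  exact (injOn_placeInSquare N).bijOn_image

theorem bijOn_Phi (N : ℕ) : Set.BijOn (Phi N) Set.univ (dividedSquares N) :=
  ((bijOn_placeInSquare N).comp (bijOn_columnComplement N)).comp (bijOn_knuthMap N)

/-! ### Cardinalities. -/

lemma ncard_univ_matrix (N : ℕ) :
    (Set.univ : Set (Matrix (Fin N) (Fin N) (Fin 2))).ncard = 2 ^ (N ^ 2) := by
  rw [Set.ncard_univ, Matrix, Nat.card_fun, Nat.card_fun]
  simp [sq, pow_mul]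

lemma finite_complementaryPairs (N : ℕ) : (complementaryPairs N).Finite := by
  rw [← ((bijOn_columnComplement N).comp (bijOn_knuthMap N)).image_eq]
  exact Set.finite_univ.image _

theorem ncard_complementaryPairs (N : ℕ) : (complementaryPairs N).ncard = 2 ^ (N ^ 2) := by
  have h := (bijOn_columnComplement N).comp (bijOn_knuthMap N)
  rw [← h.image_eq, h.injOn.ncard_image, ncard_univ_matrix]

theorem ncard_dividedSquares (N : ℕ) : (dividedSquares N).ncard = 2 ^ (N ^ 2) := by
  rw [← (bijOn_Phi N).image_eq, (bijOn_Phi N).injOn.ncard_image, ncard_univ_matrix]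

/-! ### Squares whose first tableau has a first row of maximal length -/

lemma AreComplementary.swap {N : ℕ} {μ : YoungDiagram} {A B : ℕ → ℕ → ℕ}
    (h : AreComplementary N μ A B) : AreComplementary N (complementDiagram N μ) B A :=
  ⟨fitsInSquare_complementDiagram N μ, h.2.2, by
    rw [complementDiagram_complementDiagram h.1]; exact h.2.1⟩

lemma IsYoungTableau.ne_zero_iff {N : ℕ} {μ : YoungDiagram} {T : ℕ → ℕ → ℕ}
    (h : IsYoungTableau N μ T) {i j : ℕ} : T i j ≠ 0 ↔ (i, j) ∈ μ := by
  obtain ⟨-, -, hzero, hrange⟩ := isYoungTableau_iff.1 h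
  constructor
  · exact fun hne => by_contra fun hn => hne (hzero i j hn)
  · intro hm
    have := hrange i j hm
    omega

lemma rowLen_eq_iff {N : ℕ} (hN : 1 ≤ N) {μ : YoungDiagram} (hμ : FitsInSquare N μ) :
    μ.rowLen 0 = N ↔ (0, N - 1) ∈ μ := by
  rw [YoungDiagram.mem_iff_lt_rowLen]
  have : μ.rowLen 0 ≤ N := by
    by_contra h
    have := hμ 0 N (YoungDiagram.mem_iff_lt_rowLen.2 (not_le.1 h))
    omega
  omega

/-- The box `(0, N - 1)` of the square belongs to exactly one of two complementary tableaux. -/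
lemma AreComplementary.ne_zero_iff {N : ℕ} (hN : 1 ≤ N) {μ : YoungDiagram} {A B : ℕ → ℕ → ℕ}
    (h : AreComplementary N μ A B) : B 0 (N - 1) ≠ 0 ↔ A 0 (N - 1) = 0 := by
  -- The box `(0, N - 1)` is fixed by `(i, j) ↦ (N - 1 - j, N - 1 - i)`.
  rw [h.2.2.ne_zero_iff, mem_complementDiagram, ← not_iff_not, not_and_or, not_not, ← ne_eq,
    h.2.1.ne_zero_iff, Nat.sub_self, Nat.sub_zero]
  exact or_iff_right (by omega)

lemma alpha_eq_ncard {N : ℕ} (hN : 1 ≤ N) :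
    alpha N = {p ∈ complementaryPairs N | p.1 0 (N - 1) ≠ 0}.ncard := by
  rw [alpha, ← ((injOn_placeInSquare N).mono (Set.sep_subset _ _)).ncard_image]
  congr 1
  ext S
  constructor
  · rintro ⟨μ, A, B, h, hrow, rfl⟩
    exact ⟨(A, B), ⟨⟨μ, h⟩, h.2.1.ne_zero_iff.2 ((rowLen_eq_iff hN h.1).1 hrow)⟩, rfl⟩
  · rintro ⟨⟨A, B⟩, ⟨⟨μ, h⟩, hne⟩, rfl⟩
    exact ⟨μ, A, B, h, (rowLen_eq_iff hN h.1).2 (h.2.1.ne_zero_iff.1 hne), rfl⟩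

lemma image_swap_complementaryPairs {N : ℕ} (hN : 1 ≤ N) :
    Prod.swap '' {p ∈ complementaryPairs N | p.1 0 (N - 1) ≠ 0} =
      {p ∈ complementaryPairs N | ¬ p.1 0 (N - 1) ≠ 0} := by
  ext ⟨A, B⟩
  constructor
  · rintro ⟨⟨B', A'⟩, ⟨⟨μ, h⟩, hne⟩, he⟩
    simp only [Prod.swap_prod_mk, Prod.mk.injEq] at he
    obtain ⟨rfl, rfl⟩ := he
    refine ⟨⟨_, h.swap⟩, not_not.2 ?_⟩
    exact (h.swap.ne_zero_iff hN).1 hne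
  · rintro ⟨⟨μ, h⟩, h0⟩
    exact ⟨(B, A), ⟨⟨_, h.swap⟩, (h.ne_zero_iff hN).2 (not_not.1 h0)⟩, rfl⟩

/-- Swapping the two tableaux matches the pairs counted by `alpha N` with all the remaining ones. -/
theorem alpha_eq {N : ℕ} (hN : 1 ≤ N) : alpha N = 2 ^ (N ^ 2 - 1) := by
  have hfin := finite_complementaryPairs N
  have h1 : {p ∈ complementaryPairs N | ¬ p.1 0 (N - 1) ≠ 0}.ncard = alpha N := by
    rw [← image_swap_complementaryPairs hN, Set.ncard_image_of_injective _ Prod.swap_injective,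
      alpha_eq_ncard hN]
  have h2 : alpha N + alpha N = 2 ^ (N ^ 2) := by
    nth_rewrite 2 [← h1]
    rw [alpha_eq_ncard hN, ← ncard_complementaryPairs,
      ← Set.ncard_union_eq ?_ (hfin.subset (Set.sep_subset _ _))
      (hfin.subset (Set.sep_subset _ _))]
    · congr 1
      ext p
      simp only [Set.mem_union, Set.mem_ofPred_eq]
      tauto
    · rw [Set.disjoint_left]
      exact fun p hp hp' => hp'.2 hp.2
  have h3 : 2 ^ (N ^ 2) = 2 * 2 ^ (N ^ 2 - 1) := by
    rw [← pow_succ', Nat.sub_add_cancel (Nat.one_le_pow _ _ hN)]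
  omega

end SquareTableaux

theorem mainTheorem4 (N : ℕ) :
    Set.BijOn (SquareTableaux.knuthMap N) Set.univ (SquareTableaux.conjugatePairs N) ∧
    Set.BijOn
      (fun p : (ℕ → ℕ → ℕ) × (ℕ → ℕ → ℕ) => (p.1, SquareTableaux.columnComplement N p.2))
      (SquareTableaux.conjugatePairs N) (SquareTableaux.complementaryPairs N) ∧
    Set.BijOn (SquareTableaux.Phi N) Set.univ (SquareTableaux.dividedSquares N) ∧
    (SquareTableaux.dividedSquares N).ncard = 2 ^ (N ^ 2) ∧
    (1 ≤ N → SquareTableaux.alpha N = 2 ^ (N ^ 2 - 1)) :=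
  ⟨SquareTableaux.bijOn_knuthMap N, SquareTableaux.bijOn_columnComplement N,
    SquareTableaux.bijOn_Phi N, SquareTableaux.ncard_dividedSquares N, SquareTableaux.alpha_eq⟩
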